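/- Let $K$ be a number field with algebraic closure $\overline K$, let $b\in K$, $b\neq 0$, and let $E_1$ be the elliptic curve $y^2=x^3+bx$ over $K$. Let $K_7=K(E_1[7])\subset\overline K$ be the field generated over $K$ by the coordinates of all affine points $P\in E_1(\overline K)$ with $7P=O$. Let $i\in\overline K$ with $i^2=-1$ and let $\zeta=\zeta_7\in\overline K$ be a primitive 7th root of unity. Put $$\begin{aligned} \omega_1&=(6i+4)\zeta^5+(6i-2)\zeta^4+(2i-2)\zeta^3+(2i+4)\zeta^2+8i\zeta+4i-3,\\ \omega_3&=(2i+2)\zeta^5+6\zeta^4+(-4i+6)\zeta^3+(-6i+2)\zeta^2-4i\zeta-2i-1,\\ \omega_5&=(4i-6)\zeta^5+(-2i-4)\zeta^4+(6i-4)\zeta^3-6\zeta^2+4i\zeta+2i-7,\\ \theta_1&=\tfrac17\big((-3520i-1568)\zeta^5+(-4800i+2352)\zeta^4+(-256i+2352)\zeta^3+(-1536i-1568)\zeta^2-5056i\zeta-2528i+3584\big),\\ \theta_3&=\tfrac17\big((-256i-2352)\zeta^5+(1280i-3920)\zeta^4+(3264i-3920)\zeta^3+(4800i-2352)\zeta^2+4544i\zeta+2272i+1232\big),\\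 \theta_5&=\tfrac17\big((-3264i+3920)\zeta^5+(1536i+1568)\zeta^4+(-3520i+1568)\zeta^3+(1280i+3920)\zeta^2-1984i\zeta-992i+5152\big), \end{aligned}$$ and for $s\in\{1,3,5\}$ let $\omega_{s+1}$, $\theta_{s+1}$ be obtained from $\omega_s$, $\theta_s$ by the automorphism of $\mathbb Q(i,\zeta)$ with $i\mapsto -i$, $\zeta\mapsto\zeta$. Then the following hold. 1. For every $j\in\{1,\dots,6\}$, every sign $\varepsilon\in\{+1,-1\}$ and every choice of the square roots, put $$x=\sqrt{\omega_jb+\varepsilon\tfrac12 b\sqrt{\theta_j}},\qquad y=\sqrt{\Big(\omega_j+\varepsilon\tfrac12\sqrt{\theta_j}+1\Big)\,b\,x},$$ with the same $\sqrt{\theta_j}$ in both formulas. Then $(x,y)$ is a point of $E_1$ of exact order $7$, and $$K_7=K(i,\zeta_7,y).$$ 2. The $7$-division polynomial of $E_1$ is $q_7(x)=\tilde q_7(x^2)$, where $$\begin{aligned}\tilde q_7(t)={}&7t^{12}+308bt^{11}-2954b^2t^{10}-19852b^3t^9-35231b^4t^8-82264b^5t^7-111916b^6t^6\\&-42168b^7t^5+15673b^8t^4+14756b^9t^3+1302b^{10}t^2+196b^{11}t-b^{12};\end{aligned}$$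 an affine point $(x,y)\in E_1(\overline K)$ satisfies $7(x,y)=O$ if and only if $q_7(x)=0$. For every choice of the square roots $\sqrt{\theta_j}$, $$\tilde q_7(t)=7\prod_{j=1}^6\Big(t-\big(\omega_jb+\tfrac12b\sqrt{\theta_j}\big)\Big)\Big(t-\big(\omega_jb-\tfrac12b\sqrt{\theta_j}\big)\Big).$$ 3. Let $\phi_1(x,y)=(-x,iy)$ (and $\phi_1(O)=O$). For every point $P\in E_1(\overline K)$ of exact order $7$, $\{P,\phi_1(P)\}$ is a basis of $E_1[7]$ over $\mathbb Z/7\mathbb Z$. -/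

import Mathlib

noncomputable section

namespace SevenDivision

open Polynomial

/-- The curve `E₁ : y² = x³ + b x`. -/
def curve {K : Type*} [Field K] (b : K) : WeierstrassCurve K :=
  ⟨0, 0, 0, b, 0⟩

/-- The group `E₁(L)` of points of `E₁ : y² = x³ + b x` with coordinates in an extension `L`
of the base field. -/
abbrev Pt {K : Type*} [Field K] (b : K) (L : Type*) [Field L] [Algebra K L] : Type _ :=
  ((curve b).baseChange L).toAffine.Point

/-- The `m`-division field `K(E₁[m])`: the subfield of `L` generated over `K` by the coordinates
of the affine points of `E₁(L)` killed by `m` (for `L` an algebraic closure of `K`). -/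
def divisionField {K : Type*} [Field K] (b : K) (L : Type*) [Field L] [DecidableEq L]
    [Algebra K L] (m : ℕ) : IntermediateField K L :=
  IntermediateField.adjoin K
    {c : L | ∃ (x y : L) (h : ((curve b).baseChange L).toAffine.Nonsingular x y),
      m • (WeierstrassCurve.Affine.Point.some x y h : Pt b L) = 0 ∧ (c = x ∨ c = y)}

theorem nonsingular_cm {K : Type*} [Field K] {b : K} {L : Type*} [Field L] [Algebra K L]
    {i : L} (hi : i ^ 2 = -1) {x y : L}
    (h : ((curve b).baseChange L).toAffine.Nonsingular x y) :
    ((curve b).baseChange L).toAffine.Nonsingular (-x) (i * y) := by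
  have hi0 : i ≠ 0 := by
    rintro rfl
    simp at hi
  rw [WeierstrassCurve.Affine.nonsingular_iff', WeierstrassCurve.Affine.equation_iff] at h ⊢
  simp only [WeierstrassCurve.baseChange, WeierstrassCurve.map, curve, map_zero, zero_mul,
    mul_zero, add_zero, zero_sub, neg_ne_zero] at h ⊢
  refine ⟨by linear_combination (y ^ 2) * hi - h.1, h.2.imp (fun h => ?_) (fun h => ?_)⟩
  · simpa using h
  · intro h'
    exact h (mul_left_cancel₀ hi0 (by linear_combination h'))

/-- The complex multiplication `φ₁ (x, y) = (-x, i y)` of `E₁`, where `i² = -1`. -/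
def cm {K : Type*} [Field K] (b : K) {L : Type*} [Field L] [Algebra K L]
    (i : L) (hi : i ^ 2 = -1) : Pt b L → Pt b L
  | .zero => .zero
  | .some x y h => .some (-x) (i * y) (nonsingular_cm hi h)

/-- The polynomial of degree 12 in `t = x²` that gives the `7`-division polynomial of `E₁`. -/
def q7t {K : Type*} [Field K] (b : K) : K[X] :=
  7 * X ^ 12 + C (308 * b) * X ^ 11 - C (2954 * b ^ 2) * X ^ 10 - C (19852 * b ^ 3) * X ^ 9
    - C (35231 * b ^ 4) * X ^ 8 - C (82264 * b ^ 5) * X ^ 7 - C (111916 * b ^ 6) * X ^ 6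
    - C (42168 * b ^ 7) * X ^ 5 + C (15673 * b ^ 8) * X ^ 4 + C (14756 * b ^ 9) * X ^ 3
    + C (1302 * b ^ 10) * X ^ 2 + C (196 * b ^ 11) * X - C (b ^ 12)

/-- The `7`-division polynomial of `E₁`, of degree 24 in `x`. -/
def q7 {K : Type*} [Field K] (b : K) : K[X] :=
  (q7t b).comp (X ^ 2)

section Constants

variable {L : Type*} [Field L] (i z : L)

def omega1 : L :=
  (6 * i + 4) * z ^ 5 + (6 * i - 2) * z ^ 4 + (2 * i - 2) * z ^ 3 + (2 * i + 4) * z ^ 2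
    + 8 * i * z + 4 * i - 3

/-- The image of `omega1` under `i ↦ i`, `ζ₇ ↦ ζ₇⁵`. -/
def omega3 : L :=
  (2 * i + 2) * z ^ 5 + 6 * z ^ 4 + (-4 * i + 6) * z ^ 3 + (-6 * i + 2) * z ^ 2
    - 4 * i * z - 2 * i - 1

/-- The image of `omega3` under `i ↦ i`, `ζ₇ ↦ ζ₇⁵`. -/
def omega5 : L :=
  (4 * i - 6) * z ^ 5 + (-2 * i - 4) * z ^ 4 + (6 * i - 4) * z ^ 3 - 6 * z ^ 2
    + 4 * i * z + 2 * i - 7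

def theta1 : L :=
  (1 / 7) * ((-3520 * i - 1568) * z ^ 5 + (-4800 * i + 2352) * z ^ 4 + (-256 * i + 2352) * z ^ 3
    + (-1536 * i - 1568) * z ^ 2 - 5056 * i * z - 2528 * i + 3584)

/-- The image of `theta1` under `i ↦ i`, `ζ₇ ↦ ζ₇⁵`. -/
def theta3 : L :=
  (1 / 7) * ((-256 * i - 2352) * z ^ 5 + (1280 * i - 3920) * z ^ 4 + (3264 * i - 3920) * z ^ 3
    + (4800 * i - 2352) * z ^ 2 + 4544 * i * z + 2272 * i + 1232)

/-- The image of `theta3` under `i ↦ i`, `ζ₇ ↦ ζ₇⁵`. -/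
def theta5 : L :=
  (1 / 7) * ((-3264 * i + 3920) * z ^ 5 + (1536 * i + 1568) * z ^ 4 + (-3520 * i + 1568) * z ^ 3
    + (1280 * i + 3920) * z ^ 2 - 1984 * i * z - 992 * i + 5152)

/-- `ω₁, …, ω₆` (at the indices `0, …, 5`). For `s = 1, 3, 5`, `ω_{s+1}` is the conjugate of `ω_s`
under `i ↦ -i`, `ζ₇ ↦ ζ₇`; this equals the conjugate under `i ↦ i`, `ζ₇ ↦ ζ₇⁻¹`, because each
`ω_s` is fixed by `i ↦ -i`, `ζ₇ ↦ ζ₇⁻¹`. -/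
def omega : Fin 6 → L :=
  ![omega1 i z, omega1 (-i) z, omega3 i z, omega3 (-i) z, omega5 i z, omega5 (-i) z]

/-- `θ₁, …, θ₆` (at the indices `0, …, 5`), with the same conjugation as for `omega`. -/
def theta : Fin 6 → L :=
  ![theta1 i z, theta1 (-i) z, theta3 i z, theta3 (-i) z, theta5 i z, theta5 (-i) z]

end Constants

end SevenDivision

end

noncomputable section

namespace SevenDivision

open Polynomial WeierstrassCurve.Affine

/-! A nonzero point P is killed by 7 exactly when 3P = -4P, that is, when 3P and 4P have the same
abscissa. Both abscissas are rational functions of x, and clearing denominators in x(3P) = x(4P)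
gives precisely `q7t` at t = x², as displayed in `eval_q7t`. This is how `seven_nsmul_eq_zero_iff`
is proved; it goes through the group law directly, and the agreement with the recursively defined
`preΨ'` is a separate polynomial identity.

The map φ₁ is an endomorphism with φ₁² = -1. If mP + nφ₁(P) = 0 with P of order 7, applying φ₁ and
eliminating gives (m² + n²)P = 0, and since -1 is not a square mod 7, both m and n vanish mod 7. So
P and φ₁(P) have 49 distinct combinations, while the degree 24 of `q7` allows at most 2·24 + 1
points killed by 7. Hence they form a basis.

With c = ζ + ζ⁻¹ and d = i(ζ - ζ⁻¹), all ω and θ lie in ℚ(c, d), where c³ + c² - 2c - 1 = 0 and d² =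
4 - c². The factorisation (`eval_q7t_eq_prod`) is checked by eliminating first d, pairing conjugate
quadratics, and then c.

For the division field, `X_mem_of_radical` recovers x from i, ζ, y: writing x² = tb, one has y⁴ =
t(t + 1)²b³, and t is quadratic over K(i, ζ), so this relation becomes linear in t. The basis P,
φ₁(P) then yields all 7-torsion from i, x, y. Conversely iy is the ordinate of φ₁(P), so i is in the
division field; sums of roots of `q7t` give the ω's, and ζ is a ℚ(i)-linear combination of these. -/

theorem preΨ'_seven_curve {K : Type*} [Field K] (b : K) : (curve b).preΨ' 7 = q7 b := by
  have h5 : (curve b).preΨ' 5 =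
      (curve b).preΨ₄ * (curve b).Ψ₂Sq ^ 2 - (curve b).Ψ₃ ^ 3 := by
    have h := (curve b).preΨ'_odd 0
    simpa using h
  have h7 : (curve b).preΨ' 7 = (curve b).preΨ' 5 * (curve b).Ψ₃ ^ 3 -
      (curve b).preΨ₄ ^ 3 * (curve b).Ψ₂Sq ^ 2 := by
    have h := (curve b).preΨ'_odd 1
    simpa using h
  rw [h7, h5, q7, q7t]
  simp only [WeierstrassCurve.preΨ₄, WeierstrassCurve.Ψ₃, WeierstrassCurve.Ψ₂Sq,
    WeierstrassCurve.b₂, WeierstrassCurve.b₄, WeierstrassCurve.b₆, WeierstrassCurve.b₈, curve]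
  simp only [map_add, map_sub, map_mul, map_pow, map_zero, map_ofNat, add_comp, sub_comp,
    mul_comp, pow_comp, X_comp, C_comp, ofNat_comp]
  ring

/-! ### Duplication and addition formulas for abscissas. -/

section GroupLaw

variable {F : Type*} [Field F] {B : F}

theorem equation_curve_iff {x y : F} :
    (curve B).toAffine.Equation x y ↔ y ^ 2 = x ^ 3 + B * x := by
  simp [equation_iff, curve]

theorem nonsingular_curve (h2 : (2 : F) ≠ 0) (hB : B ≠ 0) {x y : F}
    (h : y ^ 2 = x ^ 3 + B * x) : (curve B).toAffine.Nonsingular x y := by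
  rw [nonsingular_iff', equation_curve_iff]
  refine ⟨h, ?_⟩
  simp only [curve, zero_mul, mul_zero, add_zero, zero_sub, neg_ne_zero]
  by_contra! hc
  obtain ⟨hx, hy⟩ := hc
  have hy0 : y = 0 := by simpa [h2] using hy
  subst hy0
  have hx' : x * (x ^ 2 + B) = 0 := by linear_combination -h
  rcases mul_eq_zero.mp hx' with rfl | hxB
  · exact hB (by linear_combination hx)
  · have : 2 * B = 0 := by linear_combination 3 * hxB - hx
    exact hB ((mul_eq_zero.mp this).resolve_left h2)

variable [DecidableEq F]

theorem exists_two_nsmul {W : WeierstrassCurve.Affine F} (hW : W = (curve B).toAffine)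
    (h2 : (2 : F) ≠ 0) {x y : F} (h : W.Nonsingular x y) (hy : y ≠ 0) :
    ∃ (x' y' : F) (h' : W.Nonsingular x' y'), 2 • Point.some x y h = Point.some x' y' h' ∧
      x' * (4 * (x ^ 3 + B * x)) = (x ^ 2 - B) ^ 2 := by
  subst hW
  have hxy := equation_curve_iff.mp h.1
  have hne : y ≠ (curve B).toAffine.negY x y := by
    intro h'
    simp only [negY, curve, zero_mul, sub_zero] at h'
    have : 2 * y = 0 := by linear_combination h'
    exact hy ((mul_eq_zero.mp this).resolve_left h2)
  refine ⟨_, _, _, (two_nsmul _).trans (Point.add_self_of_Y_ne hne), ?_⟩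
  rw [slope_of_Y_ne rfl hne, ← hxy]
  simp only [addX, negY, curve, zero_mul, mul_zero, add_zero, sub_zero, sub_neg_eq_add]
  rw [← two_mul]
  field_simp
  linear_combination (-32 * x) * hxy

/-- The abscissas of the sum and the difference are exchanged by y₂ ↦ -y₂, so their product depends
only on y₁² and y₂², which the curve equation eliminates. With the pair 2P, P the difference is P
itself, and the formula gives x(3P) without ordinates. -/
theorem X_add_mul_X_sub {W : WeierstrassCurve.Affine F} (hW : W = (curve B).toAffine)
    {x₁ y₁ x₂ y₂ x₃ y₃ x₄ y₄ : F} {h₁ : W.Nonsingular x₁ y₁} {h₂ : W.Nonsingular x₂ y₂}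
    {h₃ : W.Nonsingular x₃ y₃} {h₄ : W.Nonsingular x₄ y₄} (hx : x₁ ≠ x₂)
    (hadd : Point.some x₁ y₁ h₁ + Point.some x₂ y₂ h₂ = Point.some x₃ y₃ h₃)
    (hsub : Point.some x₁ y₁ h₁ - Point.some x₂ y₂ h₂ = Point.some x₄ y₄ h₄) :
    x₃ * x₄ * (x₁ - x₂) ^ 2 = (x₁ * x₂ - B) ^ 2 := by
  subst hW
  have e₁ := equation_curve_iff.mp h₁.1
  have e₂ := equation_curve_iff.mp h₂.1
  rw [Point.add_of_X_ne hx, Point.some.injEq] at hadd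
  rw [sub_eq_add_neg, Point.neg_some, Point.add_of_X_ne hx, Point.some.injEq] at hsub
  have hd : x₁ - x₂ ≠ 0 := sub_ne_zero.mpr hx
  have h₃' : x₃ * (x₁ - x₂) ^ 2 = (y₁ - y₂) ^ 2 - (x₁ + x₂) * (x₁ - x₂) ^ 2 := by
    rw [← hadd.1, slope_of_X_ne hx]
    simp only [addX, curve, zero_mul, add_zero, sub_zero]
    field_simp
    ring
  have h₄' : x₄ * (x₁ - x₂) ^ 2 = (y₁ + y₂) ^ 2 - (x₁ + x₂) * (x₁ - x₂) ^ 2 := by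
    rw [← hsub.1, slope_of_X_ne hx]
    simp only [addX, negY, curve, zero_mul, add_zero, sub_zero, sub_neg_eq_add]
    field_simp
    ring
  refine mul_right_cancel₀ (pow_ne_zero 2 hd) ?_
  linear_combination x₄ * (x₁ - x₂) ^ 2 * h₃' +
    ((y₁ - y₂) ^ 2 - (x₁ + x₂) * (x₁ - x₂) ^ 2) * h₄' +
    (e₁ - e₂) * (y₁ ^ 2 - y₂ ^ 2 + (x₁ ^ 3 + B * x₁) - (x₂ ^ 3 + B * x₂)) -
    2 * (x₁ + x₂) * (x₁ - x₂) ^ 2 * (e₁ + e₂)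

end GroupLaw

/-! ### The equation x(3P) = x(4P) and the points killed by 7. -/

section SevenTorsion

variable {F : Type*} [Field F] {B : F}

/-- The right side is the cross-multiplied difference of x(3P) and x(4P) as functions of t = x². -/
theorem eval_q7t (t : F) : (q7t B).eval t =
    16 * t * (t + B) * (t - B) ^ 2 * (t ^ 2 + 6 * B * t + B ^ 2) ^ 2 *
        (t ^ 2 - 6 * B * t - 3 * B ^ 2) ^ 2 -
      (3 * t ^ 2 + 6 * B * t - B ^ 2) ^ 2 *
        (t ^ 4 - 20 * B * t ^ 3 - 26 * B ^ 2 * t ^ 2 - 20 * B ^ 3 * t + B ^ 4) ^ 2 := by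
  simp only [q7t, eval_add, eval_sub, eval_mul, eval_pow, eval_X, eval_C, eval_ofNat]
  ring

/-- The excluded factors are those whose zeros are abscissas of points of order 2 (t, t + B), 4 (t -
B and t² + 6Bt + B²) and 3 (the last one). At a common zero with `q7t` what remains is a power of 2
times a power of B, or a product of factors already known to be nonzero. -/
theorem ne_zero_of_eval_q7t_eq_zero (h2 : (2 : F) ≠ 0) (hB : B ≠ 0) {t : F}
    (ht : (q7t B).eval t = 0) :
    t ≠ 0 ∧ t + B ≠ 0 ∧ t - B ≠ 0 ∧ t ^ 2 + 6 * B * t + B ^ 2 ≠ 0 ∧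
      3 * t ^ 2 + 6 * B * t - B ^ 2 ≠ 0 := by
  rw [eval_q7t] at ht
  have hpow (k n : ℕ) : (2 : F) ^ k * B ^ n ≠ 0 :=
    mul_ne_zero (pow_ne_zero _ h2) (pow_ne_zero _ hB)
  have h0 : t ≠ 0 := by
    rintro rfl
    exact hpow 0 12 (by linear_combination -ht)
  have hadd : t + B ≠ 0 := by
    intro h
    obtain rfl : t = -B := by linear_combination h
    exact hpow 12 12 (by linear_combination -ht)
  have hsub : t - B ≠ 0 := by
    intro h
    obtain rfl : t = B := by linear_combination h
    exact hpow 18 12 (by linear_combination -ht)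
  have hM : t ^ 2 + 6 * B * t + B ^ 2 ≠ 0 := by
    intro h
    rw [h] at ht
    rcases mul_eq_zero.mp (show (3 * t ^ 2 + 6 * B * t - B ^ 2) *
      (t ^ 4 - 20 * B * t ^ 3 - 26 * B ^ 2 * t ^ 2 - 20 * B ^ 3 * t + B ^ 4) = 0 from
        pow_eq_zero_iff two_ne_zero |>.mp (by linear_combination -ht)) with h' | h'
    · have : 2 * ((t + B) * (t - B)) = 0 := by linear_combination h' - h
      exact mul_ne_zero h2 (mul_ne_zero hadd hsub) this
    · refine mul_ne_zero (hpow 7 2) (pow_ne_zero 2 h0) ?_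
      linear_combination h' - (t ^ 2 - 26 * B * t + B ^ 2) * h
  refine ⟨h0, hadd, hsub, hM, fun h => ?_⟩
  rw [h] at ht
  have hP : t ^ 2 - 6 * B * t - 3 * B ^ 2 = 0 := by
    have h16 : (16 : F) ≠ 0 := (by norm_num : (16 : F) = 2 ^ 4) ▸ pow_ne_zero 4 h2
    by_contra hP
    refine mul_ne_zero (mul_ne_zero (mul_ne_zero (mul_ne_zero (mul_ne_zero h16 h0) hadd)
      (pow_ne_zero 2 hsub)) (pow_ne_zero 2 hM)) (pow_ne_zero 2 hP) ?_
    linear_combination ht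
  have : 4 * ((t + B) * (t - B)) = 0 := by linear_combination h + hP
  have h4 : (4 : F) ≠ 0 := (by norm_num : (4 : F) = 2 ^ 2) ▸ pow_ne_zero 2 h2
  exact mul_ne_zero h4 (mul_ne_zero hadd hsub) this

/-- This is y(2P)² with denominators cleared; its numerator is a square and vanishes exactly when 4P
= O, provided 2P is affine. -/
theorem X_two_nsmul_cubic {x x₂ : F} (e : x₂ * (4 * (x ^ 3 + B * x)) = (x ^ 2 - B) ^ 2) :
    (x₂ ^ 3 + B * x₂) * (4 * (x ^ 3 + B * x)) ^ 3 =
      (x ^ 2 - B) ^ 2 * (x ^ 4 + 6 * B * x ^ 2 + B ^ 2) ^ 2 := by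
  linear_combination ((x₂ * (4 * (x ^ 3 + B * x))) ^ 2 +
    x₂ * (4 * (x ^ 3 + B * x)) * (x ^ 2 - B) ^ 2 + ((x ^ 2 - B) ^ 2) ^ 2 + B * (4 * (x ^ 3 + B * x)) ^ 2) * e

variable [DecidableEq F]

/-- Equal abscissas mean nP = ±(n + 1)P, and the plus sign would force P = 0. -/
theorem X_nsmul_eq_X_succ_nsmul_iff {W : WeierstrassCurve.Affine F} {P : W.Point} (hP : P ≠ 0)
    {x₁ y₁ x₂ y₂ : F} {h₁ : W.Nonsingular x₁ y₁} {h₂ : W.Nonsingular x₂ y₂} {n : ℕ}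
    (hn : n • P = Point.some x₁ y₁ h₁) (hn' : (n + 1) • P = Point.some x₂ y₂ h₂) :
    x₁ = x₂ ↔ (2 * n + 1) • P = 0 := by
  rw [Point.X_eq_iff (h₁ := h₁) (h₂ := h₂), ← hn, ← hn']
  constructor
  · rintro (h | h)
    · rw [succ_nsmul, left_eq_add] at h
      exact absurd h hP
    · rw [show 2 * n + 1 = n + (n + 1) by ring, add_nsmul, h, neg_add_cancel]
  · intro h
    rw [show 2 * n + 1 = n + (n + 1) by ring, add_nsmul] at h
    exact .inr (eq_neg_of_add_eq_zero_left h)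

/-- The abscissas of the points of order `7` are the roots of `q7`. -/
theorem seven_nsmul_eq_zero_iff {W : WeierstrassCurve.Affine F} (hW : W = (curve B).toAffine)
    (h2 : (2 : F) ≠ 0) (hB : B ≠ 0) {x y : F} (h : W.Nonsingular x y) :
    7 • Point.some x y h = 0 ↔ (q7t B).eval (x ^ 2) = 0 := by
  set P := Point.some x y h with hPdef
  have hP0 : P ≠ 0 := Point.some_ne_zero h
  have hxy : y ^ 2 = x ^ 3 + B * x := by
    subst hW; exact equation_curve_iff.mp h.1
  -- the equivalence, as long as the multiples up to `4 • P` are affine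
  have key (hy : y ≠ 0) {x₂ y₂ : F} (h₂ : W.Nonsingular x₂ y₂)
      (hP₂ : 2 • P = Point.some x₂ y₂ h₂)
      (e₂ : x₂ * (4 * (x ^ 3 + B * x)) = (x ^ 2 - B) ^ 2) (hx : x ≠ x₂) (hy₂ : y₂ ≠ 0) :
      7 • P = 0 ↔ (q7t B).eval (x ^ 2) = 0 := by
    have hxy₂ : y₂ ^ 2 = x₂ ^ 3 + B * x₂ := by
      subst hW; exact equation_curve_iff.mp h₂.1
    obtain ⟨x₄, y₄, h₄, hP₄, e₄⟩ := exists_two_nsmul hW h2 h₂ hy₂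
    have hP₄' : (3 + 1) • P = Point.some x₄ y₄ h₄ := by
      rw [← hP₄, ← hP₂, ← mul_nsmul]
    have h3P : 3 • P ≠ 0 := fun h0 =>
      hx ((X_nsmul_eq_X_succ_nsmul_iff (n := 1) hP0 ((one_nsmul P).trans hPdef) hP₂).mpr h0)
    obtain ⟨x₃, y₃, h₃, hP₃⟩ : ∃ x₃ y₃ h₃, 3 • P = Point.some x₃ y₃ h₃ := by
      cases h : 3 • P with
      | zero => exact absurd h h3P
      | some x₃ y₃ h₃ => exact ⟨x₃, y₃, h₃, rfl⟩
    have e₃ : x₃ * x * (x₂ - x) ^ 2 = (x₂ * x - B) ^ 2 := by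
      refine X_add_mul_X_sub hW (h₁ := h₂) (h₂ := h) (h₃ := h₃) (h₄ := h) hx.symm ?_ ?_
      · rw [← hP₂, ← hP₃, ← hPdef, ← succ_nsmul]
      · rw [← hP₂, ← hPdef, two_nsmul, add_sub_cancel_right]
    rw [← X_nsmul_eq_X_succ_nsmul_iff hP0 hP₃ hP₄', eval_q7t]
    have hD : x ^ 3 + B * x ≠ 0 := hxy ▸ pow_ne_zero 2 hy
    have hx0 : x ≠ 0 := by rintro rfl; simp at hD
    have h4 : (4 : F) ≠ 0 := (by norm_num : (4 : F) = 2 ^ 2) ▸ pow_ne_zero 2 h2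
    have hD4 : 4 * (x ^ 3 + B * x) ≠ 0 := mul_ne_zero h4 hD
    have hψ : (x₂ - x) * (4 * (x ^ 3 + B * x)) = -(3 * x ^ 4 + 6 * B * x ^ 2 - B ^ 2) := by
      linear_combination e₂
    have hψ0 : 3 * x ^ 4 + 6 * B * x ^ 2 - B ^ 2 ≠ 0 := by
      rw [← neg_ne_zero, ← hψ]
      exact mul_ne_zero (sub_ne_zero.mpr hx.symm) hD4
    have hN : (x₂ ^ 3 + B * x₂) * (4 * (x ^ 3 + B * x)) ^ 3 =
        (x ^ 2 - B) ^ 2 * (x ^ 4 + 6 * B * x ^ 2 + B ^ 2) ^ 2 :=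
      X_two_nsmul_cubic e₂
    have hN0 : (x ^ 2 - B) ^ 2 * (x ^ 4 + 6 * B * x ^ 2 + B ^ 2) ^ 2 ≠ 0 := by
      rw [← hN, ← hxy₂]
      exact mul_ne_zero (pow_ne_zero 2 hy₂) (pow_ne_zero 3 hD4)
    have e₃' : x₃ * (3 * x ^ 4 + 6 * B * x ^ 2 - B ^ 2) ^ 2 =
        x * (x ^ 4 - 6 * B * x ^ 2 - 3 * B ^ 2) ^ 2 := by
      refine mul_left_cancel₀ hx0 ?_
      linear_combination (4 * (x ^ 3 + B * x)) ^ 2 * e₃ -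
        x₃ * x * ((x₂ - x) * (4 * (x ^ 3 + B * x)) - (3 * x ^ 4 + 6 * B * x ^ 2 - B ^ 2)) * hψ +
        x * (x * x₂ * (4 * (x ^ 3 + B * x)) + x * (x ^ 2 - B) ^ 2 -
          2 * B * (4 * (x ^ 3 + B * x))) * e₂
    have e₄' : x₄ * (16 * (x ^ 3 + B * x) *
          ((x ^ 2 - B) ^ 2 * (x ^ 4 + 6 * B * x ^ 2 + B ^ 2) ^ 2)) =
        (x ^ 8 - 20 * B * x ^ 6 - 26 * B ^ 2 * x ^ 4 - 20 * B ^ 3 * x ^ 2 + B ^ 4) ^ 2 := by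
      linear_combination (4 * (x ^ 3 + B * x)) ^ 4 * e₄ - x₄ * 4 * (4 * (x ^ 3 + B * x)) * hN +
        (x₂ * (4 * (x ^ 3 + B * x)) + (x ^ 2 - B) ^ 2) *
          (x₂ ^ 2 * (4 * (x ^ 3 + B * x)) ^ 2 + ((x ^ 2 - B) ^ 2) ^ 2 - 2 * B * (4 * (x ^ 3 + B * x)) ^ 2) * e₂
    -- The product of the denominators of x(3P) and x(4P), nonzero because 2P, 3P and 4P are affine;
    -- multiplying x₃ = x₄ by it produces the form in `eval_q7t`.
    have hc : (3 * x ^ 4 + 6 * B * x ^ 2 - B ^ 2) ^ 2 * (16 * (x ^ 3 + B * x) *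
        ((x ^ 2 - B) ^ 2 * (x ^ 4 + 6 * B * x ^ 2 + B ^ 2) ^ 2)) ≠ 0 := by
      refine mul_ne_zero (pow_ne_zero 2 hψ0) (mul_ne_zero ?_ hN0)
      convert mul_ne_zero h4 hD4 using 1
      ring
    rw [← mul_left_inj' hc, ← sub_eq_zero]
    refine Eq.congr_left ?_
    linear_combination (16 * (x ^ 3 + B * x) *
        ((x ^ 2 - B) ^ 2 * (x ^ 4 + 6 * B * x ^ 2 + B ^ 2) ^ 2)) * e₃' -
      (3 * x ^ 4 + 6 * B * x ^ 2 - B ^ 2) ^ 2 * e₄'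
  constructor
  · intro h7
    -- The factor k is the inverse of -n mod 7, so nP = 0 and 7P = 0 together give P = 0. It is used
    -- for n = 2, 3, 4, where k = 3, 2, 5.
    have hne (n m k : ℕ) (hnk : n * k + 1 = 7 * m) : n • P ≠ 0 := by
      intro hn
      apply hP0
      have : (n * k + 1) • P = 0 := by rw [hnk, mul_nsmul, h7, nsmul_zero]
      rwa [succ_nsmul, mul_nsmul, hn, nsmul_zero, zero_add] at this
    have hy : y ≠ 0 := by
      rintro rfl
      refine hne 2 1 3 rfl ?_
      rw [two_nsmul, hPdef]
      subst hW
      exact Point.add_self_of_Y_eq (by simp [negY, curve])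
    obtain ⟨x₂, y₂, h₂, hP₂, e₂⟩ := exists_two_nsmul hW h2 h hy
    refine (key hy h₂ hP₂ e₂ ?_ ?_).mp h7
    · intro hx
      exact hne 3 1 2 rfl ((X_nsmul_eq_X_succ_nsmul_iff (n := 1) hP0
        ((one_nsmul P).trans hPdef) hP₂).mp hx)
    · rintro rfl
      refine hne 4 3 5 rfl ?_
      rw [show 4 = 2 * 2 from rfl, mul_nsmul, hP₂, two_nsmul]
      subst hW
      exact Point.add_self_of_Y_eq (by simp [negY, curve])
  · intro hq
    obtain ⟨h0, hadd, hsub, hM, hψ⟩ := ne_zero_of_eval_q7t_eq_zero h2 hB hq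
    have hx0 : x ≠ 0 := by rintro rfl; simp at h0
    have hy : y ≠ 0 := by
      rintro rfl
      refine mul_ne_zero hx0 hadd ?_
      linear_combination -hxy
    obtain ⟨x₂, y₂, h₂, hP₂, e₂⟩ := exists_two_nsmul hW h2 h hy
    have hxy₂ : y₂ ^ 2 = x₂ ^ 3 + B * x₂ := by
      subst hW; exact equation_curve_iff.mp h₂.1
    refine (key hy h₂ hP₂ e₂ ?_ ?_).mpr hq
    · rintro rfl
      apply hψ
      linear_combination e₂
    · rintro rfl
      refine mul_ne_zero (pow_ne_zero 2 hsub) (pow_ne_zero 2 hM) ?_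
      linear_combination -(X_two_nsmul_cubic e₂) - (4 * (x ^ 3 + B * x)) ^ 3 * hxy₂

end SevenTorsion

/-! ### Complex multiplication and independence of P and φ₁(P). -/

section Torsion

variable {K : Type*} [Field K] {b : K} {L : Type*} [Field L] [Algebra K L]

theorem baseChange_curve : ((curve b).baseChange L).toAffine =
    (curve (algebraMap K L b)).toAffine := by
  simp [curve, WeierstrassCurve.baseChange, WeierstrassCurve.map]

theorem aeval_q7 (x : L) : aeval x (q7 b) = (q7t (algebraMap K L b)).eval (x ^ 2) := by
  simp [q7, q7t, _root_.map_ofNat]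

theorem nonsingular_baseChange_curve (h2 : (2 : L) ≠ 0) (hb : b ≠ 0) {x y : L}
    (h : y ^ 2 = x ^ 3 + algebraMap K L b * x) :
    ((curve b).baseChange L).toAffine.Nonsingular x y := by
  rw [baseChange_curve]
  exact nonsingular_curve h2 ((_root_.map_ne_zero _).mpr hb) h

theorem equation_of_nonsingular {x y : L}
    (h : ((curve b).baseChange L).toAffine.Nonsingular x y) :
    y ^ 2 = x ^ 3 + algebraMap K L b * x := by
  rw [baseChange_curve] at h
  exact equation_curve_iff.mp h.1

theorem negY_baseChange_curve (x y : L) : ((curve b).baseChange L).toAffine.negY x y = -y := by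
  simp [negY, curve]

section

variable [DecidableEq L]

theorem seven_nsmul_some_eq_zero_iff (h2 : (2 : L) ≠ 0) (hb : b ≠ 0) {x y : L}
    (h : ((curve b).baseChange L).toAffine.Nonsingular x y) :
    7 • (Point.some x y h : Pt b L) = 0 ↔ aeval x (q7 b) = 0 := by
  rw [aeval_q7]
  exact seven_nsmul_eq_zero_iff baseChange_curve h2 ((_root_.map_ne_zero _).mpr hb) h

/-- A chord slope is scaled by i/(-1) = -i. For a tangent, 3x² + b is unchanged and 2y is scaled by
i, which gives 1/i = -i again. -/
theorem slope_cm {i : L} (hi : i ^ 2 = -1) (x₁ x₂ y₁ y₂ : L) :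
    ((curve b).baseChange L).toAffine.slope (-x₁) (-x₂) (i * y₁) (i * y₂) =
      -i * ((curve b).baseChange L).toAffine.slope x₁ x₂ y₁ y₂ := by
  have hi0 : i ≠ 0 := by rintro rfl; simp at hi
  have hinv : i⁻¹ = -i := inv_eq_of_mul_eq_one_right (by linear_combination -hi)
  by_cases hx : x₁ = x₂
  · subst hx
    by_cases hy : y₁ = ((curve b).baseChange L).toAffine.negY x₁ y₂
    · rw [slope_of_Y_eq rfl hy, slope_of_Y_eq rfl, mul_zero]
      rw [negY_baseChange_curve] at hy ⊢
      rw [hy, mul_neg]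
    · have hy' : i * y₁ ≠ ((curve b).baseChange L).toAffine.negY (-x₁) (i * y₂) := by
        rw [negY_baseChange_curve] at hy ⊢
        rw [← mul_neg]
        exact fun h => hy (mul_left_cancel₀ hi0 h)
      rw [slope_of_Y_ne rfl hy, slope_of_Y_ne rfl hy', negY_baseChange_curve,
        negY_baseChange_curve]
      simp only [WeierstrassCurve.baseChange, WeierstrassCurve.map, curve, map_zero, mul_zero,
        zero_mul, add_zero, sub_zero, neg_sq]
      rw [sub_neg_eq_add, sub_neg_eq_add, ← mul_add, mul_comm i, ← div_div, div_eq_mul_inv _ i,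
        hinv]
      ring
  · rw [slope_of_X_ne hx, slope_of_X_ne (by simpa using hx), ← mul_sub,
      show -x₁ - -x₂ = -(x₁ - x₂) by ring, div_neg]
    ring

theorem cm_add {i : L} (hi : i ^ 2 = -1) (P Q : Pt b L) :
    cm b i hi (P + Q) = cm b i hi P + cm b i hi Q := by
  have hi0 : i ≠ 0 := by rintro rfl; simp at hi
  rcases P with _ | ⟨x₁, y₁, h₁⟩
  · change cm b i hi (0 + Q) = 0 + cm b i hi Q
    rw [zero_add, zero_add]
  rcases Q with _ | ⟨x₂, y₂, h₂⟩
  · change cm b i hi (_ + 0) = _ + 0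
    rw [add_zero, add_zero]
  by_cases hxy : x₁ = x₂ ∧ y₁ = ((curve b).baseChange L).toAffine.negY x₂ y₂
  · rw [Point.add_of_Y_eq hxy.1 hxy.2]
    simp only [cm]
    rw [Point.add_of_Y_eq (by rw [hxy.1])]
    · rfl
    · rw [hxy.2, negY_baseChange_curve, negY_baseChange_curve, mul_neg]
  · have hxy' : ¬(-x₁ = -x₂ ∧
        i * y₁ = ((curve b).baseChange L).toAffine.negY (-x₂) (i * y₂)) := by
      rw [negY_baseChange_curve] at hxy ⊢
      rw [neg_inj, ← mul_neg]
      exact fun h => hxy ⟨h.1, mul_left_cancel₀ hi0 h.2⟩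
    rw [Point.add_some hxy]
    simp only [cm]
    rw [Point.add_some hxy', Point.some.injEq, slope_cm hi]
    generalize ((curve b).baseChange L).toAffine.slope x₁ x₂ y₁ y₂ = ℓ
    simp only [addY, negAddY, addX, negY_baseChange_curve]
    simp only [WeierstrassCurve.baseChange, WeierstrassCurve.map, curve, map_zero]
    constructor
    · linear_combination -ℓ ^ 2 * hi
    · linear_combination (-i * ℓ ^ 3) * hi

/-- The complex multiplication as an endomorphism of the group of points. -/
def cmHom (b : K) {i : L} (hi : i ^ 2 = -1) : Pt b L →+ Pt b L where
  toFun := cm b i hi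
  map_zero' := rfl
  map_add' := cm_add hi

theorem cmHom_cmHom {i : L} (hi : i ^ 2 = -1) (P : Pt b L) :
    cmHom b hi (cmHom b hi P) = -P := by
  rcases P with _ | ⟨x, y, h⟩
  · rfl
  · change Point.some _ _ _ = _
    rw [Point.neg_some, Point.some.injEq, negY_baseChange_curve]
    exact ⟨neg_neg x, by linear_combination y * hi⟩

/-- Elimination between the relation and its image under φ₁ leaves (m² + n²)P = 0; as 7 ≡ 3 mod 4,
the form m² + n² is anisotropic mod 7. -/
theorem zsmul_add_zsmul_cmHom_eq_zero {i : L} (hi : i ^ 2 = -1) {P : Pt b L}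
    (hP : addOrderOf P = 7) {m n : ℤ} (h : m • P + n • cmHom b hi P = 0) :
    (7 : ℤ) ∣ m ∧ (7 : ℤ) ∣ n := by
  have h' : m • cmHom b hi P - n • P = 0 := by
    simpa [cmHom_cmHom, sub_eq_add_neg] using congrArg (cmHom b hi) h
  have hmn : (m ^ 2 + n ^ 2) • P = 0 := by
    have : (m ^ 2 + n ^ 2) • P = m • (m • P + n • cmHom b hi P) -
        n • (m • cmHom b hi P - n • P) := by module
    rw [this, h, h', smul_zero, smul_zero, sub_zero]
  rw [← addOrderOf_dvd_iff_zsmul_eq_zero, hP] at hmn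
  have key : ∀ u v : ZMod 7, u ^ 2 + v ^ 2 = 0 → u = 0 ∧ v = 0 := by decide
  have := key m n (by
    have := (ZMod.intCast_zmod_eq_zero_iff_dvd (m ^ 2 + n ^ 2) 7).mpr hmn
    exact_mod_cast this)
  exact ⟨(ZMod.intCast_zmod_eq_zero_iff_dvd m 7).mp this.1,
    (ZMod.intCast_zmod_eq_zero_iff_dvd n 7).mp this.2⟩

theorem nsmul_add_nsmul_cm_injective {i : L} (hi : i ^ 2 = -1) {P : Pt b L}
    (hP : addOrderOf P = 7) :
    Function.Injective fun c : Fin 7 × Fin 7 => (c.1 : ℕ) • P + (c.2 : ℕ) • cm b i hi P := by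
  rintro ⟨u, v⟩ ⟨u', v'⟩ h
  change (u : ℕ) • P + (v : ℕ) • cmHom b hi P = (u' : ℕ) • P + (v' : ℕ) • cmHom b hi P at h
  have h0 : ((u : ℤ) - u') • P + ((v : ℤ) - v') • cmHom b hi P = 0 := by
    rw [← sub_eq_zero] at h
    rw [← h]
    simp only [sub_smul, natCast_zsmul]
    abel
  have := zsmul_add_zsmul_cmHom_eq_zero hi hP h0
  ext <;> simp only <;> omega

end

/-! ### At most 49 points are killed by 7. -/

section Counting

/-- The coordinates of a point, if it is affine. -/
def coords : Pt b L → Option (L × L)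
  | .zero => none
  | .some x y _ => some (x, y)

theorem coords_injective : Function.Injective (coords (b := b) (L := L)) := by
  rintro (_ | ⟨x, y, h⟩) (_ | ⟨x', y', h'⟩) hc
  · rfl
  · simp [coords] at hc
  · simp [coords] at hc
  · simp only [coords, Option.some.injEq, Prod.mk.injEq] at hc
    obtain ⟨rfl, rfl⟩ := hc
    rfl

variable [IsAlgClosed L]

theorem exists_finset_coords_seven_torsion [DecidableEq L] (h2 : (2 : L) ≠ 0) (hb : b ≠ 0) :
    ∃ S : Finset (Option (L × L)), S.card ≤ 49 ∧
      ∀ Q : Pt b L, 7 • Q = 0 → coords Q ∈ S := by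
  have hB : algebraMap K L b ≠ 0 := (_root_.map_ne_zero _).mpr hb
  set p : L[X] := (q7t (algebraMap K L b)).comp (X ^ 2) with hp
  have hp0 : p ≠ 0 := by
    intro h
    have : p.eval 0 = 0 := by rw [h, eval_zero]
    rw [hp, eval_comp, eval_q7t] at this
    refine pow_ne_zero 12 hB ?_
    simp only [eval_pow, eval_X] at this
    linear_combination -this
  have hdeg : p.natDegree ≤ 24 := by
    have : (q7t (algebraMap K L b)).natDegree ≤ 12 := by
      unfold q7t
      compute_degree
    rw [hp, natDegree_comp, natDegree_X_pow]
    omega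
  -- Over each root x of the polynomial the possible ordinates are w x and -w x, so two copies of
  -- the root set, together with `none` for O, suffice.
  choose w hw using fun x : L =>
    IsAlgClosed.exists_pow_nat_eq (x ^ 3 + algebraMap K L b * x) two_pos
  refine ⟨insert none (p.roots.toFinset.image (fun x => some (x, w x)) ∪
    p.roots.toFinset.image (fun x => some (x, -w x))), ?_, ?_⟩
  · have hr : p.roots.toFinset.card ≤ 24 :=
      (Multiset.toFinset_card_le _).trans ((card_roots' p).trans hdeg)
    have h₁ := Finset.card_insert_le none
      (p.roots.toFinset.image (fun x => some (x, w x)) ∪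
        p.roots.toFinset.image (fun x => some (x, -w x)))
    have h₂ := Finset.card_union_le (p.roots.toFinset.image (fun x => some (x, w x)))
      (p.roots.toFinset.image (fun x => some (x, -w x)))
    have h₃ := Finset.card_image_le (s := p.roots.toFinset) (f := fun x => some (x, w x))
    have h₄ := Finset.card_image_le (s := p.roots.toFinset) (f := fun x => some (x, -w x))
    omega
  · rintro (_ | ⟨x, y, h⟩) hQ
    · exact Finset.mem_insert_self _ _
    · rw [seven_nsmul_some_eq_zero_iff h2 hb, aeval_q7] at hQ
      have hx : x ∈ p.roots.toFinset := by
        rw [Multiset.mem_toFinset, mem_roots hp0, IsRoot, hp, eval_comp, eval_pow, eval_X, hQ]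
      have hyw : y ^ 2 = w x ^ 2 := by rw [hw, equation_of_nonsingular h]
      apply Finset.mem_insert_of_mem
      rcases sq_eq_sq_iff_eq_or_eq_neg.mp hyw with rfl | rfl
      · exact Finset.mem_union_left _ (Finset.mem_image_of_mem (fun x => some (x, w x)) hx)
      · exact Finset.mem_union_right _ (Finset.mem_image_of_mem (fun x => some (x, -w x)) hx)

/-- `P` and its image under the complex multiplication form a basis of the `7`-torsion. -/
theorem seven_nsmul_eq_zero_iff_existsUnique [DecidableEq L] (h2 : (2 : L) ≠ 0) (hb : b ≠ 0)
    {i : L} (hi : i ^ 2 = -1) {P : Pt b L} (hP : addOrderOf P = 7) (Q : Pt b L) :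
    7 • Q = 0 ↔ ∃! c : Fin 7 × Fin 7, Q = (c.1 : ℕ) • P + (c.2 : ℕ) • cm b i hi P := by
  have hinj := nsmul_add_nsmul_cm_injective hi hP
  have h7P : 7 • P = 0 := hP ▸ addOrderOf_nsmul_eq_zero P
  have htors (c : Fin 7 × Fin 7) : 7 • ((c.1 : ℕ) • P + (c.2 : ℕ) • cm b i hi P) = 0 := by
    have : 7 • cm b i hi P = 0 := by
      change 7 • cmHom b hi P = 0
      rw [← map_nsmul, h7P, map_zero]
    rw [nsmul_add, nsmul_left_comm, h7P, nsmul_left_comm, this, nsmul_zero, nsmul_zero, add_zero]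
  constructor
  · intro hQ
    obtain ⟨S, hS, hmem⟩ := exists_finset_coords_seven_torsion (L := L) h2 hb
    -- The 49 distinct combinations lie in a set of at most 49 elements, hence fill it.
    have himage : Finset.univ.image (fun c : Fin 7 × Fin 7 =>
        coords ((c.1 : ℕ) • P + (c.2 : ℕ) • cm b i hi P)) = S := by
      refine Finset.eq_of_subset_of_card_le ?_ ?_
      · intro s hs
        obtain ⟨c, -, rfl⟩ := Finset.mem_image.mp hs
        exact hmem _ (htors c)
      · have hcard := Finset.card_image_of_injective Finset.univ (coords_injective.comp hinj)
        simp only [Finset.card_univ, Fintype.card_prod, Fintype.card_fin] at hcard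
        exact hS.trans hcard.ge
    have hQS := hmem Q hQ
    rw [← himage] at hQS
    obtain ⟨c, -, hc⟩ := Finset.mem_image.mp hQS
    have hc' := coords_injective hc
    exact ⟨c, hc'.symm, fun c' h' => hinj (h'.symm.trans hc'.symm)⟩
  · rintro ⟨c, hc, -⟩
    rw [hc, htors]

end Counting

end Torsion

/-! ### The constants ω and θ in terms of c = ζ + ζ⁻¹ and d = i(ζ - ζ⁻¹). -/

section Constants

variable {F : Type*} [Field F] {i z : F}

theorem cubic_eq {c : F}
    (hz : z ^ 6 + z ^ 5 + z ^ 4 + z ^ 3 + z ^ 2 + z + 1 = 0) (hc : c = z + z ^ 6) :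
    c ^ 3 + c ^ 2 - 2 * c - 1 = 0 := by
  subst hc
  linear_combination
    (z ^ 12 - z ^ 11 + 3 * z ^ 7 - 2 * z ^ 6 - z ^ 4 + 3 * z ^ 2 - z - 1) * hz

theorem sq_eq {c d : F} (hi : i ^ 2 = -1)
    (hz : z ^ 6 + z ^ 5 + z ^ 4 + z ^ 3 + z ^ 2 + z + 1 = 0) (hc : c = z + z ^ 6)
    (hd : d = i * (z - z ^ 6)) : d ^ 2 + c ^ 2 - 4 = 0 := by
  subst hc hd
  linear_combination (z ^ 12 - 2 * z ^ 7 + z ^ 2) * hi + (4 * z - 4) * hz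

/-- Invariance under i ↦ -i, ζ ↦ ζ⁻¹ puts the constant in ℚ(c, d). The automorphism i ↦ -i, ζ ↦ ζ
then only changes the sign of d. -/
theorem omega1_eq (hz : z ^ 6 + z ^ 5 + z ^ 4 + z ^ 3 + z ^ 2 + z + 1 = 0)
    {c d : F} (hc : c = z + z ^ 6) (hd : d = i * (z - z ^ 6)) :
    omega1 i z =
      6 * c ^ 2 + 2 * c - 13 + d * (-2 * c ^ 2 - 2 * c + 6) := by
  subst hc hd
  rw [omega1]
  linear_combination
    (-2 * i * z ^ 12 + 2 * i * z ^ 11 - 2 * i * z ^ 7 + 2 * i * z ^ 4 + 2 * i * z ^ 2 - 2 * i *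
      z + 4 * i - 6 * z ^ 6 + 6 * z ^ 5 - 12 * z + 10) * hz

theorem omega3_eq (hz : z ^ 6 + z ^ 5 + z ^ 4 + z ^ 3 + z ^ 2 + z + 1 = 0)
    {c d : F} (hc : c = z + z ^ 6) (hd : d = i * (z - z ^ 6)) :
    omega3 i z =
      -4 * c ^ 2 - 6 * c + 1 + d * (-2 * c ^ 2 - 4 * c) := by
  subst hc hd
  rw [omega3]
  linear_combination
    (-2 * i * z ^ 12 + 2 * i * z ^ 11 - 2 * i * z ^ 7 - 2 * i * z ^ 6 + 2 * i * z ^ 5 + 2 * i *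
      z ^ 4 + 2 * i * z ^ 2 - 2 * i * z - 2 * i + 4 * z ^ 6 - 4 * z ^ 5 + 8 * z - 2) * hz

theorem omega5_eq (hz : z ^ 6 + z ^ 5 + z ^ 4 + z ^ 3 + z ^ 2 + z + 1 = 0)
    {c d : F} (hc : c = z + z ^ 6) (hd : d = i * (z - z ^ 6)) :
    omega5 i z =
      -2 * c ^ 2 + 4 * c + 1 + d * (4 * c ^ 2 - 2 * c - 2) := by
  subst hc hd
  rw [omega5]
  linear_combination
    (4 * i * z ^ 12 - 4 * i * z ^ 11 + 4 * i * z ^ 7 - 6 * i * z ^ 6 + 6 * i * z ^ 5 - 4 * i *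
      z ^ 4 - 4 * i * z ^ 2 + 4 * i * z + 2 * i + 2 * z ^ 6 - 2 * z ^ 5 + 4 * z - 8) * hz

/-- This brings ζ into the division field once i and the ω's are there. -/
theorem eq_linear_combination_omega (hi : i ^ 2 = -1) :
    1232 * z = (2 - 55 * i) * omega1 i z + (2 + 55 * i) * omega1 (-i) z +
      (-20 + 33 * i) * omega3 i z + (-20 - 33 * i) * omega3 (-i) z +
      (46 - 11 * i) * omega5 i z + (46 + 11 * i) * omega5 (-i) z := by
  simp only [omega1, omega3, omega5]
  linear_combination (616 * z ^ 5 + 616 * z ^ 4 + 616 * z ^ 3 + 616 * z ^ 2 + 1232 * z + 616) * hi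

variable [CharZero F]

theorem theta1_eq (hz : z ^ 6 + z ^ 5 + z ^ 4 + z ^ 3 + z ^ 2 + z + 1 = 0)
    {c d : F} (hc : c = z + z ^ 6) (hd : d = i * (z - z ^ 6)) :
    theta1 i z =
      1 / 7 * (-3920 * c ^ 2 - 2352 * c + 9072 + d * (2272 * c ^ 2 + 992 * c - 4800)) := by
  subst hc hd
  rw [theta1]
  linear_combination
    1 / 7 * (2272 * i * z ^ 12 - 2272 * i * z ^ 11 + 2272 * i * z ^ 7 - 1280 * i * z ^ 6 + 1280
      * i * z ^ 5 - 2272 * i * z ^ 4 - 2272 * i * z ^ 2 + 2272 * i * z - 2528 * i + 3920 * z ^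
      6 - 3920 * z ^ 5 + 7840 * z - 5488) * hz

theorem theta3_eq (hz : z ^ 6 + z ^ 5 + z ^ 4 + z ^ 3 + z ^ 2 + z + 1 = 0)
    {c d : F} (hc : c = z + z ^ 6) (hd : d = i * (z - z ^ 6)) :
    theta3 i z =
      1 / 7 * (1568 * c ^ 2 + 3920 * c + 2016 + d * (992 * c ^ 2 + 2528 * c + 1280)) := by
  subst hc hd
  rw [theta3]
  linear_combination
    1 / 7 * (992 * i * z ^ 12 - 992 * i * z ^ 11 + 992 * i * z ^ 7 + 1536 * i * z ^ 6 - 1536 *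
      i * z ^ 5 - 992 * i * z ^ 4 - 992 * i * z ^ 2 + 992 * i * z + 2272 * i - 1568 * z ^ 6 +
      1568 * z ^ 5 - 3136 * z - 784) * hz

theorem theta5_eq (hz : z ^ 6 + z ^ 5 + z ^ 4 + z ^ 3 + z ^ 2 + z + 1 = 0)
    {c d : F} (hc : c = z + z ^ 6) (hd : d = i * (z - z ^ 6)) :
    theta5 i z =
      1 / 7 * (2352 * c ^ 2 - 1568 * c - 1120 + d * (-2528 * c ^ 2 + 2272 * c + 1536)) := by
  subst hc hd
  rw [theta5]
  linear_combination
    1 / 7 * (-2528 * i * z ^ 12 + 2528 * i * z ^ 11 - 2528 * i * z ^ 7 + 4800 * i * z ^ 6 -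
      4800 * i * z ^ 5 + 2528 * i * z ^ 4 + 2528 * i * z ^ 2 - 2528 * i * z - 992 * i - 2352 *
      z ^ 6 + 2352 * z ^ 5 - 4704 * z + 6272) * hz

/-- This quantity is the product of the two values t = ω ± √θ/2, the constant term of their
quadratic polynomial. -/
theorem omega1_sq_sub_theta1 (hi : i ^ 2 = -1)
    (hz : z ^ 6 + z ^ 5 + z ^ 4 + z ^ 3 + z ^ 2 + z + 1 = 0)
    {c d : F} (hc : c = z + z ^ 6) (hd : d = i * (z - z ^ 6)) :
    omega1 i z ^ 2 - theta1 i z / 4 =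
      1 / 7 * (28 * c ^ 2 + 28 * c - 77 + d * (-36 * c ^ 2 + 4 * c + 52)) := by
  rw [omega1_eq hz hc hd, theta1_eq hz hc hd]
  linear_combination
    (4 * c ^ 4 + 8 * c ^ 3 - 20 * c ^ 2 - 24 * c + 36) * sq_eq hi hz hc hd +
    (-4 * c ^ 3 - 4 * c ^ 2 - 24 * c * d + 68 * c - 8 * d) * cubic_eq hz hc

/-- Reducing t(t + 1)² modulo (t - ω)² = θ/4 leaves this expression as the coefficient of t;
`X_mem_of_radical` divides by it. -/
theorem omega1_theta1_ne_zero (hi : i ^ 2 = -1)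
    (hz : z ^ 6 + z ^ 5 + z ^ 4 + z ^ 3 + z ^ 2 + z + 1 = 0) :
    3 * omega1 i z ^ 2 + 4 * omega1 i z + 1 + theta1 i z / 4 ≠ 0 := by
  obtain ⟨c, hc⟩ : ∃ c, c = z + z ^ 6 := ⟨_, rfl⟩
  obtain ⟨d, hd⟩ : ∃ d, d = i * (z - z ^ 6) := ⟨_, rfl⟩
  have ho := omega1_eq hz hc hd
  have hn := omega1_sq_sub_theta1 hi hz hc hd
  intro h
  have hA : (2 * omega1 i z + 1) ^ 2 - (omega1 i z ^ 2 - theta1 i z / 4) = 0 := by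
    linear_combination h
  rw [hn, ho] at hA
  -- The multiplier of `hA` is 1356 times the inverse of the element in ℚ(c, d), with denominators
  -- cleared; the other two terms reduce the product by the relations for d and c.
  have : (1356 : F) = 0 := by
    linear_combination
      (-292 * c ^ 2 * d - 734 * c ^ 2 - 660 * c * d - 786 * c + 181 * d + 609) * hA -
      1 / 7 * (-32704 * c ^ 6 * d + 114016 * c ^ 6 - 139328 * c ^ 5 * d + 452704 * c ^ 5 +
        35952 * c ^ 4 * d - 169664 * c ^ 4 + 606368 * c ^ 3 * d - 1826688 * c ^ 3 + 47824 * c ^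
        2 * d - 91748 * c ^ 2 - 786912 * c * d + 1979092 * c + 182448 * d - 155740) * sq_eq hi
        hz hc hd -
      1 / 7 * (32704 * c ^ 5 * d - 114016 * c ^ 5 + 106624 * c ^ 4 * d - 338688 * c ^ 4 - 9072
        * c ^ 3 * d - 3488 * c ^ 3 - 584304 * c ^ 2 * d + 1564064 * c ^ 2 - 364776 * c * d +
        610188 * c + 1053864 * d - 2078816) * cubic_eq hz hc
  norm_num at this

/-- The two factors differ by d ↦ -d, so the product involves d only through d² = 4 - c² and has
coefficients in ℚ(c). -/
theorem quadratic_mul_conj1 (hi : i ^ 2 = -1)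
    (hz : z ^ 6 + z ^ 5 + z ^ 4 + z ^ 3 + z ^ 2 + z + 1 = 0)
    (T B : F) {c : F} (hc : c = z + z ^ 6) :
    ((T - omega1 i z * B) ^ 2 - B ^ 2 * theta1 i z / 4) *
        ((T - omega1 (-i) z * B) ^ 2 - B ^ 2 * theta1 (-i) z / 4) =
      1 / 7 * (7 * T ^ 4 - 168 * T ^ 3 * B * c ^ 2 - 56 * T ^ 3 * B * c + 364 * T ^ 3 * B + 56
        * T ^ 2 * B ^ 2 * c ^ 2 + 56 * T ^ 2 * B ^ 2 * c - 126 * T ^ 2 * B ^ 2 - 56 * T * B ^ 3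
        * c ^ 2 + 56 * T * B ^ 3 * c + 28 * T * B ^ 3 - 88 * B ^ 4 * c ^ 2 + 72 * B ^ 4 * c +
        47 * B ^ 4) := by
  obtain ⟨d, hd⟩ : ∃ d, d = i * (z - z ^ 6) := ⟨_, rfl⟩
  have hi' : (-i) ^ 2 = -1 := by rw [neg_sq, hi]
  have hd' : -d = -i * (z - z ^ 6) := by rw [hd, neg_mul]
  have key : (T - omega1 i z * B) ^ 2 - B ^ 2 * theta1 i z / 4 =
      T ^ 2 - 2 * (6 * c ^ 2 + 2 * c - 13 + d * (-2 * c ^ 2 - 2 * c + 6)) * T * B + (1 / 7 *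
        (28 * c ^ 2 + 28 * c - 77 + d * (-36 * c ^ 2 + 4 * c + 52))) * B ^ 2 := by
    linear_combination -2 * T * B * omega1_eq hz hc hd +
      B ^ 2 * omega1_sq_sub_theta1 hi hz hc hd
  have key' : (T - omega1 (-i) z * B) ^ 2 - B ^ 2 * theta1 (-i) z / 4 =
      T ^ 2 - 2 * (6 * c ^ 2 + 2 * c - 13 - d * (-2 * c ^ 2 - 2 * c + 6)) * T * B + (1 / 7 *
        (28 * c ^ 2 + 28 * c - 77 - d * (-36 * c ^ 2 + 4 * c + 52))) * B ^ 2 := by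
    linear_combination -2 * T * B * omega1_eq hz hc hd' +
      B ^ 2 * omega1_sq_sub_theta1 hi' hz hc hd'
  rw [key, key']
  linear_combination
    1 / 49 * (-784 * T ^ 2 * B ^ 2 * c ^ 4 - 1568 * T ^ 2 * B ^ 2 * c ^ 3 + 3920 * T ^ 2 * B ^
      2 * c ^ 2 + 4704 * T ^ 2 * B ^ 2 * c - 7056 * T ^ 2 * B ^ 2 + 2016 * T * B ^ 3 * c ^ 4 +
      1792 * T * B ^ 3 * c ^ 3 - 9184 * T * B ^ 3 * c ^ 2 - 2240 * T * B ^ 3 * c + 8736 * T * B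
      ^ 3 - 1296 * B ^ 4 * c ^ 4 + 288 * B ^ 4 * c ^ 3 + 3728 * B ^ 4 * c ^ 2 - 416 * B ^ 4 * c
      - 2704 * B ^ 4) * sq_eq hi hz hc hd +
    1 / 49 * (784 * T ^ 2 * B ^ 2 * c ^ 3 + 784 * T ^ 2 * B ^ 2 * c ^ 2 + 784 * T ^ 2 * B ^ 2 *
      c - 4704 * T ^ 2 * B ^ 2 - 2016 * T * B ^ 3 * c ^ 3 + 224 * T * B ^ 3 * c ^ 2 + 8288 * T
      * B ^ 3 * c - 6720 * T * B ^ 3 + 1296 * B ^ 4 * c ^ 3 - 1584 * B ^ 4 * c ^ 2 - 3952 * B ^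
      4 * c + 5216 * B ^ 4) * cubic_eq hz hc

theorem omega3_sq_sub_theta3 (hi : i ^ 2 = -1)
    (hz : z ^ 6 + z ^ 5 + z ^ 4 + z ^ 3 + z ^ 2 + z + 1 = 0)
    {c d : F} (hc : c = z + z ^ 6) (hd : d = i * (z - z ^ 6)) :
    omega3 i z ^ 2 - theta3 i z / 4 =
      1 / 7 * (-28 * c - 49 + d * (4 * c ^ 2 - 16 * c - 40)) := by
  rw [omega3_eq hz hc hd, theta3_eq hz hc hd]
  linear_combination
    (4 * c ^ 4 + 16 * c ^ 3 + 16 * c ^ 2) * sq_eq hi hz hc hd +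
    (-4 * c ^ 3 - 12 * c ^ 2 + 16 * c * d + 20 * c + 40 * d + 64) * cubic_eq hz hc

theorem omega3_theta3_ne_zero (hi : i ^ 2 = -1)
    (hz : z ^ 6 + z ^ 5 + z ^ 4 + z ^ 3 + z ^ 2 + z + 1 = 0) :
    3 * omega3 i z ^ 2 + 4 * omega3 i z + 1 + theta3 i z / 4 ≠ 0 := by
  obtain ⟨c, hc⟩ : ∃ c, c = z + z ^ 6 := ⟨_, rfl⟩
  obtain ⟨d, hd⟩ : ∃ d, d = i * (z - z ^ 6) := ⟨_, rfl⟩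
  have ho := omega3_eq hz hc hd
  have hn := omega3_sq_sub_theta3 hi hz hc hd
  intro h
  have hA : (2 * omega3 i z + 1) ^ 2 - (omega3 i z ^ 2 - theta3 i z / 4) = 0 := by
    linear_combination h
  rw [hn, ho] at hA
  have : (1356 : F) = 0 := by
    linear_combination
      (-660 * c ^ 2 * d - 52 * c ^ 2 + 111 * c * d + 734 * c + 368 * d - 21) * hA -
      1 / 7 * (-73920 * c ^ 6 * d - 301504 * c ^ 6 - 283248 * c ^ 5 * d - 926240 * c ^ 5 -
        204736 * c ^ 4 * d - 131424 * c ^ 4 + 214592 * c ^ 3 * d + 1237740 * c ^ 3 + 164864 * c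
        ^ 2 * d + 359968 * c ^ 2 - 113320 * c + 14720) * sq_eq hi hz hc hd -
      1 / 7 * (73920 * c ^ 5 * d + 301504 * c ^ 5 + 209328 * c ^ 4 * d + 624736 * c ^ 4 -
        471408 * c ^ 3 * d - 1119616 * c ^ 3 - 973616 * c ^ 2 * d - 2013164 * c ^ 2 + 207408 *
        c * d + 455148 * c - 40376 * d - 47036) * cubic_eq hz hc
  norm_num at this

theorem quadratic_mul_conj3 (hi : i ^ 2 = -1)
    (hz : z ^ 6 + z ^ 5 + z ^ 4 + z ^ 3 + z ^ 2 + z + 1 = 0)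
    (T B : F) {c : F} (hc : c = z + z ^ 6) :
    ((T - omega3 i z * B) ^ 2 - B ^ 2 * theta3 i z / 4) *
        ((T - omega3 (-i) z * B) ^ 2 - B ^ 2 * theta3 (-i) z / 4) =
      1 / 7 * (7 * T ^ 4 + 112 * T ^ 3 * B * c ^ 2 + 168 * T ^ 3 * B * c - 28 * T ^ 3 * B - 56
        * T ^ 2 * B ^ 2 * c - 70 * T ^ 2 * B ^ 2 + 112 * T * B ^ 3 * c ^ 2 + 56 * T * B ^ 3 * c
        - 252 * T * B ^ 3 + 160 * B ^ 4 * c ^ 2 + 88 * B ^ 4 * c - 361 * B ^ 4) := by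
  obtain ⟨d, hd⟩ : ∃ d, d = i * (z - z ^ 6) := ⟨_, rfl⟩
  have hi' : (-i) ^ 2 = -1 := by rw [neg_sq, hi]
  have hd' : -d = -i * (z - z ^ 6) := by rw [hd, neg_mul]
  have key : (T - omega3 i z * B) ^ 2 - B ^ 2 * theta3 i z / 4 =
      T ^ 2 - 2 * (-4 * c ^ 2 - 6 * c + 1 + d * (-2 * c ^ 2 - 4 * c)) * T * B + (1 / 7 * (-28 *
        c - 49 + d * (4 * c ^ 2 - 16 * c - 40))) * B ^ 2 := by
    linear_combination -2 * T * B * omega3_eq hz hc hd +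
      B ^ 2 * omega3_sq_sub_theta3 hi hz hc hd
  have key' : (T - omega3 (-i) z * B) ^ 2 - B ^ 2 * theta3 (-i) z / 4 =
      T ^ 2 - 2 * (-4 * c ^ 2 - 6 * c + 1 - d * (-2 * c ^ 2 - 4 * c)) * T * B + (1 / 7 * (-28 *
        c - 49 - d * (4 * c ^ 2 - 16 * c - 40))) * B ^ 2 := by
    linear_combination -2 * T * B * omega3_eq hz hc hd' +
      B ^ 2 * omega3_sq_sub_theta3 hi' hz hc hd'
  rw [key, key']
  linear_combination
    1 / 49 * (-784 * T ^ 2 * B ^ 2 * c ^ 4 - 3136 * T ^ 2 * B ^ 2 * c ^ 3 - 3136 * T ^ 2 * B ^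
      2 * c ^ 2 - 224 * T * B ^ 3 * c ^ 4 + 448 * T * B ^ 3 * c ^ 3 + 4032 * T * B ^ 3 * c ^ 2
      + 4480 * T * B ^ 3 * c - 16 * B ^ 4 * c ^ 4 + 128 * B ^ 4 * c ^ 3 + 64 * B ^ 4 * c ^ 2 -
      1280 * B ^ 4 * c - 1600 * B ^ 4) * sq_eq hi hz hc hd +
    1 / 49 * (784 * T ^ 2 * B ^ 2 * c ^ 3 + 2352 * T ^ 2 * B ^ 2 * c ^ 2 + 2352 * T ^ 2 * B ^ 2
      * c + 224 * T * B ^ 3 * c ^ 3 - 672 * T * B ^ 3 * c ^ 2 - 3808 * T * B ^ 3 * c - 3136 * T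
      * B ^ 3 + 16 * B ^ 4 * c ^ 3 - 144 * B ^ 4 * c ^ 2 + 48 * B ^ 4 * c + 1472 * B ^ 4) *
      cubic_eq hz hc

theorem omega5_sq_sub_theta5 (hi : i ^ 2 = -1)
    (hz : z ^ 6 + z ^ 5 + z ^ 4 + z ^ 3 + z ^ 2 + z + 1 = 0)
    {c d : F} (hc : c = z + z ^ 6) (hd : d = i * (z - z ^ 6)) :
    omega5 i z ^ 2 - theta5 i z / 4 =
      1 / 7 * (-28 * c ^ 2 + 7 + d * (16 * c ^ 2 - 36 * c - 20)) := by
  rw [omega5_eq hz hc hd, theta5_eq hz hc hd]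
  linear_combination
    (16 * c ^ 4 - 16 * c ^ 3 - 12 * c ^ 2 + 8 * c + 4) * sq_eq hi hz hc hd +
    (-16 * c ^ 3 + 32 * c ^ 2 - 16 * c * d + 16 * c + 56 * d - 56) * cubic_eq hz hc

theorem omega5_theta5_ne_zero (hi : i ^ 2 = -1)
    (hz : z ^ 6 + z ^ 5 + z ^ 4 + z ^ 3 + z ^ 2 + z + 1 = 0) :
    3 * omega5 i z ^ 2 + 4 * omega5 i z + 1 + theta5 i z / 4 ≠ 0 := by
  obtain ⟨c, hc⟩ : ∃ c, c = z + z ^ 6 := ⟨_, rfl⟩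
  obtain ⟨d, hd⟩ : ∃ d, d = i * (z - z ^ 6) := ⟨_, rfl⟩
  have ho := omega5_eq hz hc hd
  have hn := omega5_sq_sub_theta5 hi hz hc hd
  intro h
  have hA : (2 * omega5 i z + 1) ^ 2 - (omega5 i z ^ 2 - theta5 i z / 4) = 0 := by
    linear_combination h
  rw [hn, ho] at hA
  have : (1356 : F) = 0 := by
    linear_combination
      (-111 * c ^ 2 * d + 786 * c ^ 2 - 292 * c * d + 52 * c + 771 * d - 1645) * hA -
      1 / 7 * (-49728 * c ^ 6 * d + 401856 * c ^ 6 - 81088 * c ^ 5 * d - 322336 * c ^ 5 +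
        513520 * c ^ 4 * d - 1707456 * c ^ 4 - 272160 * c ^ 3 * d + 1795420 * c ^ 3 - 336896 *
        c ^ 2 * d + 912204 * c ^ 2 + 140000 * c * d - 766620 * c + 86352 * d - 298348) * sq_eq
        hi hz hc hd -
      1 / 7 * (49728 * c ^ 5 * d - 401856 * c ^ 5 + 31360 * c ^ 4 * d + 724192 * c ^ 4 -
        1008896 * c ^ 3 * d + 1875008 * c ^ 3 + 1943200 * c ^ 2 * d - 4259548 * c ^ 2 - 485020
        * c * d + 1026280 * c - 632044 * d + 1295004) * cubic_eq hz hc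
  norm_num at this

theorem quadratic_mul_conj5 (hi : i ^ 2 = -1)
    (hz : z ^ 6 + z ^ 5 + z ^ 4 + z ^ 3 + z ^ 2 + z + 1 = 0)
    (T B : F) {c : F} (hc : c = z + z ^ 6) :
    ((T - omega5 i z * B) ^ 2 - B ^ 2 * theta5 i z / 4) *
        ((T - omega5 (-i) z * B) ^ 2 - B ^ 2 * theta5 (-i) z / 4) =
      1 / 7 * (7 * T ^ 4 + 56 * T ^ 3 * B * c ^ 2 - 112 * T ^ 3 * B * c - 28 * T ^ 3 * B - 56 *
        T ^ 2 * B ^ 2 * c ^ 2 + 42 * T ^ 2 * B ^ 2 - 56 * T * B ^ 3 * c ^ 2 - 112 * T * B ^ 3 *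
        c - 28 * T * B ^ 3 - 72 * B ^ 4 * c ^ 2 - 160 * B ^ 4 * c - 57 * B ^ 4) := by
  obtain ⟨d, hd⟩ : ∃ d, d = i * (z - z ^ 6) := ⟨_, rfl⟩
  have hi' : (-i) ^ 2 = -1 := by rw [neg_sq, hi]
  have hd' : -d = -i * (z - z ^ 6) := by rw [hd, neg_mul]
  have key : (T - omega5 i z * B) ^ 2 - B ^ 2 * theta5 i z / 4 =
      T ^ 2 - 2 * (-2 * c ^ 2 + 4 * c + 1 + d * (4 * c ^ 2 - 2 * c - 2)) * T * B + (1 / 7 *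
        (-28 * c ^ 2 + 7 + d * (16 * c ^ 2 - 36 * c - 20))) * B ^ 2 := by
    linear_combination -2 * T * B * omega5_eq hz hc hd +
      B ^ 2 * omega5_sq_sub_theta5 hi hz hc hd
  have key' : (T - omega5 (-i) z * B) ^ 2 - B ^ 2 * theta5 (-i) z / 4 =
      T ^ 2 - 2 * (-2 * c ^ 2 + 4 * c + 1 - d * (4 * c ^ 2 - 2 * c - 2)) * T * B + (1 / 7 *
        (-28 * c ^ 2 + 7 - d * (16 * c ^ 2 - 36 * c - 20))) * B ^ 2 := by
    linear_combination -2 * T * B * omega5_eq hz hc hd' +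
      B ^ 2 * omega5_sq_sub_theta5 hi' hz hc hd'
  rw [key, key']
  linear_combination
    1 / 49 * (-3136 * T ^ 2 * B ^ 2 * c ^ 4 + 3136 * T ^ 2 * B ^ 2 * c ^ 3 + 2352 * T ^ 2 * B ^
      2 * c ^ 2 - 1568 * T ^ 2 * B ^ 2 * c - 784 * T ^ 2 * B ^ 2 + 1792 * T * B ^ 3 * c ^ 4 -
      4928 * T * B ^ 3 * c ^ 3 - 1120 * T * B ^ 3 * c ^ 2 + 3136 * T * B ^ 3 * c + 1120 * T * B
      ^ 3 - 256 * B ^ 4 * c ^ 4 + 1152 * B ^ 4 * c ^ 3 - 656 * B ^ 4 * c ^ 2 - 1440 * B ^ 4 * c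
      - 400 * B ^ 4) * sq_eq hi hz hc hd +
    1 / 49 * (3136 * T ^ 2 * B ^ 2 * c ^ 3 - 6272 * T ^ 2 * B ^ 2 * c ^ 2 - 1568 * T ^ 2 * B ^
      2 * c + 3136 * T ^ 2 * B ^ 2 - 1792 * T * B ^ 3 * c ^ 3 + 6720 * T * B ^ 3 * c ^ 2 - 3584
      * T * B ^ 3 * c - 4480 * T * B ^ 3 + 256 * B ^ 4 * c ^ 3 - 1408 * B ^ 4 * c ^ 2 + 2336 *
      B ^ 4 * c + 1152 * B ^ 4) * cubic_eq hz hc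

/-- The three quartics are conjugate under c ↦ c² - 2, the action of ζ ↦ ζ⁵ on c, so their product
is rational; the difference of the two sides is a multiple of the cubic relation for c. -/
theorem eval_q7t_eq_prod (hi : i ^ 2 = -1)
    (hz : z ^ 6 + z ^ 5 + z ^ 4 + z ^ 3 + z ^ 2 + z + 1 = 0) (T B : F) :
    (q7t B).eval T = 7 * ((((T - omega1 i z * B) ^ 2 - B ^ 2 * theta1 i z / 4) *
        ((T - omega1 (-i) z * B) ^ 2 - B ^ 2 * theta1 (-i) z / 4)) *
      (((T - omega3 i z * B) ^ 2 - B ^ 2 * theta3 i z / 4) *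
        ((T - omega3 (-i) z * B) ^ 2 - B ^ 2 * theta3 (-i) z / 4)) *
      (((T - omega5 i z * B) ^ 2 - B ^ 2 * theta5 i z / 4) *
        ((T - omega5 (-i) z * B) ^ 2 - B ^ 2 * theta5 (-i) z / 4))) := by
  obtain ⟨c, hc⟩ : ∃ c, c = z + z ^ 6 := ⟨_, rfl⟩
  rw [quadratic_mul_conj1 hi hz T B hc, quadratic_mul_conj3 hi hz T B hc,
    quadratic_mul_conj5 hi hz T B hc]
  simp only [q7t, eval_add, eval_sub, eval_mul, eval_pow, eval_X, eval_C, eval_ofNat]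
  linear_combination
    1 / 49 * (153664 * T ^ 10 * B ^ 2 * c + 1053696 * T ^ 9 * B ^ 3 * c ^ 3 - 1229312 * T ^ 9 *
      B ^ 3 * c ^ 2 - 3161088 * T ^ 9 * B ^ 3 * c + 1229312 * T ^ 9 * B ^ 3 - 1404928 * T ^ 8 *
      B ^ 4 * c ^ 3 - 1229312 * T ^ 8 * B ^ 4 * c ^ 2 + 3885504 * T ^ 8 * B ^ 4 * c + 1229312 *
      T ^ 8 * B ^ 4 + 702464 * T ^ 7 * B ^ 5 * c ^ 3 - 4917248 * T ^ 7 * B ^ 5 * c ^ 2 -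
      3662848 * T ^ 7 * B ^ 5 * c + 4917248 * T ^ 7 * B ^ 5 - 702464 * T ^ 6 * B ^ 6 * c ^ 3 -
      6322176 * T ^ 6 * B ^ 6 * c ^ 2 + 1386112 * T ^ 6 * B ^ 6 * c + 6322176 * T ^ 6 * B ^ 6 -
      2809856 * T ^ 5 * B ^ 7 * c ^ 3 - 351232 * T ^ 5 * B ^ 7 * c ^ 2 + 12293120 * T ^ 5 * B ^
      7 * c + 351232 * T ^ 5 * B ^ 7 - 2308096 * T ^ 4 * B ^ 8 * c ^ 3 - 8981504 * T ^ 4 * B ^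
      8 * c ^ 2 + 5111680 * T ^ 4 * B ^ 8 * c + 8981504 * T ^ 4 * B ^ 8 - 2308096 * T ^ 3 * B ^
      9 * c ^ 3 - 3713024 * T ^ 3 * B ^ 9 * c ^ 2 + 5870592 * T ^ 3 * B ^ 9 * c + 3713024 * T ^
      3 * B ^ 9 - 1648640 * T ^ 2 * B ^ 10 * c ^ 3 + 2164736 * T ^ 2 * B ^ 10 * c ^ 2 + 4115776
      * T ^ 2 * B ^ 10 * c - 2164736 * T ^ 2 * B ^ 10 - 2143232 * T * B ^ 11 * c ^ 3 - 1716736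
      * T * B ^ 11 * c ^ 2 + 4487168 * T * B ^ 11 * c + 1716736 * T * B ^ 11 - 1013760 * B ^ 12
      * c ^ 3 - 967168 * B ^ 12 * c ^ 2 + 2026176 * B ^ 12 * c + 967168 * B ^ 12) * cubic_eq hz
      hc

end Constants

/-! ### Transport along field maps and the factorisation indexed by j. -/

theorem map_omega {F L : Type*} [Field F] [Field L] (f : F →+* L) (i z : F) (j : Fin 6) :
    f (omega i z j) = omega (f i) (f z) j := by
  fin_cases j <;> simp [omega, omega1, omega3, omega5, map_ofNat]

theorem map_theta {F L : Type*} [Field F] [Field L] (f : F →+* L) (i z : F) (j : Fin 6) :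
    f (theta i z j) = theta (f i) (f z) j := by
  fin_cases j <;> simp [theta, theta1, theta3, theta5, map_ofNat]

theorem map_q7t {K L : Type*} [Field K] [Field L] (f : K →+* L) (b : K) :
    (q7t b).map f = q7t (f b) := by
  simp [q7t, map_ofNat]

theorem cyclotomic_seven_eq_zero {F : Type*} [Field F] {z : F} (hz : IsPrimitiveRoot z 7) :
    z ^ 6 + z ^ 5 + z ^ 4 + z ^ 3 + z ^ 2 + z + 1 = 0 := by
  refine mul_left_cancel₀ (sub_ne_zero.mpr (hz.ne_one (by norm_num))) ?_
  linear_combination hz.pow_eq_one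

section Constants

variable {F : Type*} [Field F] [CharZero F] {i z : F}

theorem eval_q7t_eq_prod_omega (hi : i ^ 2 = -1) (hz : IsPrimitiveRoot z 7) (T B : F) :
    (q7t B).eval T =
      7 * ∏ j : Fin 6, ((T - omega i z j * B) ^ 2 - B ^ 2 * theta i z j / 4) := by
  rw [eval_q7t_eq_prod hi (cyclotomic_seven_eq_zero hz), Fin.prod_univ_six]
  simp only [mul_assoc]
  rfl

theorem omega_theta_ne_zero (hi : i ^ 2 = -1) (hz : IsPrimitiveRoot z 7) (j : Fin 6) :
    3 * omega i z j ^ 2 + 4 * omega i z j + 1 + theta i z j / 4 ≠ 0 := by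
  have hi' : (-i) ^ 2 = -1 := by rw [neg_sq, hi]
  have hz' := cyclotomic_seven_eq_zero hz
  fin_cases j
  · exact omega1_theta1_ne_zero hi hz'
  · exact omega1_theta1_ne_zero hi' hz'
  · exact omega3_theta3_ne_zero hi hz'
  · exact omega3_theta3_ne_zero hi' hz'
  · exact omega5_theta5_ne_zero hi hz'
  · exact omega5_theta5_ne_zero hi' hz'

theorem eval_q7t_radical (hi : i ^ 2 = -1) (hz : IsPrimitiveRoot z 7) (B : F) {j : Fin 6}
    {r t : F} (hr : r ^ 2 = theta i z j) (ht : (2 * (t - omega i z j)) ^ 2 = r ^ 2) :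
    (q7t B).eval (t * B) = 0 := by
  rw [eval_q7t_eq_prod_omega hi hz, Finset.prod_eq_zero (Finset.mem_univ j), mul_zero]
  linear_combination B ^ 2 / 4 * (ht + hr)

theorem map_q7t_eq_prod {K : Type*} [Field K] [Algebra K F] (hi : i ^ 2 = -1)
    (hz : IsPrimitiveRoot z 7) (b : K) (r : Fin 6 → F) (hr : ∀ j, r j ^ 2 = theta i z j) :
    (q7t b).map (algebraMap K F) =
      7 * ∏ j : Fin 6,
        ((X - C (omega i z j * algebraMap K F b + 1 / 2 * algebraMap K F b * r j)) *
          (X - C (omega i z j * algebraMap K F b - 1 / 2 * algebraMap K F b * r j))) := by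
  refine Polynomial.funext fun T => ?_
  rw [map_q7t, eval_q7t_eq_prod_omega hi hz, eval_mul, eval_prod, eval_ofNat]
  congr 1
  refine Finset.prod_congr rfl fun j _ => ?_
  simp only [eval_mul, eval_sub, eval_X, eval_C]
  linear_combination (algebraMap K F b) ^ 2 / 4 * hr j

end Constants

/-! ### Generators of the division field. -/

section DivisionField

variable {K : Type*} [Field K] {b : K} {L : Type*} [Field L] [Algebra K L]

theorem addOrderOf_some_eq_seven [DecidableEq L] (h2 : (2 : L) ≠ 0) (hb : b ≠ 0) {x y : L}
    (h : ((curve b).baseChange L).toAffine.Nonsingular x y) (hx : aeval x (q7 b) = 0) :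
    addOrderOf (Point.some x y h : Pt b L) = 7 :=
  have : Fact (Nat.Prime 7) := ⟨by norm_num⟩
  addOrderOf_eq_prime ((seven_nsmul_some_eq_zero_iff h2 hb h).mpr hx) (Point.some_ne_zero h)

theorem mem_divisionField [DecidableEq L] (h2 : (2 : L) ≠ 0) (hb : b ≠ 0) {x y : L}
    (h : y ^ 2 = x ^ 3 + algebraMap K L b * x) (hx : aeval x (q7 b) = 0) :
    x ∈ divisionField b L 7 ∧ y ∈ divisionField b L 7 := by
  have hns := nonsingular_baseChange_curve h2 hb h
  have h7 := (seven_nsmul_some_eq_zero_iff h2 hb hns).mpr hx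
  exact ⟨IntermediateField.subset_adjoin _ _ ⟨x, y, hns, h7, .inl rfl⟩,
    IntermediateField.subset_adjoin _ _ ⟨x, y, hns, h7, .inr rfl⟩⟩

/-- The group law and φ₁ are defined over M, so the combination can be formed in E₁(M) and then
mapped to E₁(L). -/
theorem mem_of_eq_nsmul_add_nsmul_cm [DecidableEq L] (M : IntermediateField K L) {i : L}
    (hi : i ^ 2 = -1) (hiM : i ∈ M) {x y : L}
    (h : ((curve b).baseChange L).toAffine.Nonsingular x y) (hx : x ∈ M) (hy : y ∈ M)
    {x' y' : L} (h' : ((curve b).baseChange L).toAffine.Nonsingular x' y') {m n : ℕ}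
    (hQ : (Point.some x' y' h' : Pt b L) =
      m • (Point.some x y h : Pt b L) + n • cm b i hi (Point.some x y h)) :
    x' ∈ M ∧ y' ∈ M := by
  classical
  have hns : ((curve b).baseChange M).toAffine.Nonsingular (⟨x, hx⟩ : M) ⟨y, hy⟩ :=
    ((curve b).toAffine.baseChange_nonsingular (f := M.val) Subtype.val_injective _ _).mp h
  have hi' : (⟨i, hiM⟩ : M) ^ 2 = -1 := Subtype.ext (by simpa using hi)
  let P : Pt b M := Point.some _ _ hns
  have hmap : Point.map (W' := (curve b).toAffine) M.val
      (m • P + n • cm b _ hi' P) = Point.some x' y' h' := by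
    rw [hQ, map_add, map_nsmul, map_nsmul]
    rfl
  cases hR : m • P + n • cm b _ hi' P with
  | zero =>
    rw [hR] at hmap
    cases hmap
  | some u v huv =>
    rw [hR, Point.map_some, Point.some.injEq] at hmap
    exact ⟨hmap.1 ▸ u.2, hmap.2 ▸ v.2⟩

variable [CharZero L]

/-- Both (ω ± r/2)b with r² = θ are squares of abscissas of points of order 7, and their sum is 2ωb.
-/
theorem omega_mem_divisionField [DecidableEq L] [IsAlgClosed L] (hb : b ≠ 0) {i z : L}
    (hi : i ^ 2 = -1) (hz : IsPrimitiveRoot z 7) (j : Fin 6) :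
    omega i z j ∈ divisionField b L 7 := by
  have hB : algebraMap K L b ≠ 0 := (_root_.map_ne_zero _).mpr hb
  obtain ⟨r, hr⟩ := IsAlgClosed.exists_pow_nat_eq (theta i z j) two_pos
  have hmem (t : L) (ht : (2 * (t - omega i z j)) ^ 2 = r ^ 2) :
      t * algebraMap K L b ∈ divisionField b L 7 := by
    obtain ⟨x, hx⟩ := IsAlgClosed.exists_pow_nat_eq (t * algebraMap K L b) two_pos
    obtain ⟨y, hy⟩ := IsAlgClosed.exists_pow_nat_eq (x ^ 3 + algebraMap K L b * x) two_pos
    rw [← hx]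
    refine pow_mem (mem_divisionField two_ne_zero hb hy ?_).1 2
    rw [aeval_q7, hx]
    exact eval_q7t_radical hi hz _ hr ht
  have h₁ := hmem (omega i z j + r / 2) (by ring)
  have h₂ := hmem (omega i z j - r / 2) (by ring)
  have h2B : 2 * algebraMap K L b ∈ divisionField b L 7 :=
    mul_mem (ofNat_mem _ 2) (IntermediateField.algebraMap_mem _ b)
  convert div_mem (add_mem h₁ h₂) h2B using 1
  field_simp
  ring

theorem root_of_unity_mem_divisionField [DecidableEq L] [IsAlgClosed L] (hb : b ≠ 0) {i z : L}
    (hi : i ^ 2 = -1) (hz : IsPrimitiveRoot z 7) (hiD : i ∈ divisionField b L 7) :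
    z ∈ divisionField b L 7 := by
  have hω := omega_mem_divisionField hb hi hz
  choose w hw using fun j => (⟨⟨_, hω j⟩, rfl⟩ : ∃ u : divisionField b L 7, (u : L) = omega i z j)
  obtain ⟨i', rfl⟩ : ∃ u : divisionField b L 7, (u : L) = i := ⟨⟨i, hiD⟩, rfl⟩
  have h : z = (((2 - 55 * i') * w 0 + (2 + 55 * i') * w 1 + (-20 + 33 * i') * w 2 +
      (-20 - 33 * i') * w 3 + (46 - 11 * i') * w 4 + (46 + 11 * i') * w 5) / 1232 :
        divisionField b L 7) := by
    push_cast
    rw [hw, hw, hw, hw, hw, hw, eq_div_iff (by norm_num), mul_comm]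
    exact eq_linear_combination_omega hi
  rw [h]
  exact SetLike.coe_mem _

theorem X_mem_of_radical {M : IntermediateField K L} (hb : b ≠ 0) {i z : L}
    (hi : i ^ 2 = -1) (hz : IsPrimitiveRoot z 7) {j : Fin 6} {t x y : L}
    (hiM : i ∈ M) (hzM : z ∈ M) (hyM : y ∈ M)
    (ht : (2 * (t - omega i z j)) ^ 2 = theta i z j) (ht1 : t + 1 ≠ 0)
    (hx : x ^ 2 = t * algebraMap K L b) (hy : y ^ 2 = (t + 1) * algebraMap K L b * x) :
    x ∈ M := by
  have hB : algebraMap K L b ≠ 0 := (_root_.map_ne_zero _).mpr hb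
  have hBM : algebraMap K L b ∈ M := IntermediateField.algebraMap_mem _ b
  have hωM : omega i z j ∈ M := by
    have := map_omega (algebraMap M L) ⟨i, hiM⟩ ⟨z, hzM⟩ j
    exact this ▸ SetLike.coe_mem (omega (⟨i, hiM⟩ : M) ⟨z, hzM⟩ j)
  have hθM : theta i z j ∈ M := by
    have := map_theta (algebraMap M L) ⟨i, hiM⟩ ⟨z, hzM⟩ j
    exact this ▸ SetLike.coe_mem (theta (⟨i, hiM⟩ : M) ⟨z, hzM⟩ j)
  have hA := omega_theta_ne_zero hi hz j
  generalize omega i z j = w at *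
  generalize theta i z j = θ at *
  have htM : t ∈ M := by
    -- Squaring `hy` and inserting `hx` gives y⁴/b³ = t(t + 1)²; reduction by the quadratic equation
    -- of t makes this linear in t.
    have h : t = (y ^ 4 / algebraMap K L b ^ 3 + 2 * (w ^ 2 - θ / 4) * (w + 1)) /
        (3 * w ^ 2 + 4 * w + 1 + θ / 4) := by
      rw [eq_div_iff hA, ← sub_eq_iff_eq_add, eq_div_iff (pow_ne_zero 3 hB)]
      linear_combination (-(y ^ 2 + (t + 1) * algebraMap K L b * x)) * hy -
        (t + 1) ^ 2 * algebraMap K L b ^ 2 * hx -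
        algebraMap K L b ^ 3 * ((t + 2 * w + 2) / 4) * ht
    rw [h]
    have h4 : θ / 4 ∈ M := div_mem hθM (ofNat_mem _ 4)
    exact div_mem (add_mem (div_mem (pow_mem hyM 4) (pow_mem hBM 3))
        (mul_mem (mul_mem (ofNat_mem _ 2) (sub_mem (pow_mem hωM 2) h4))
          (add_mem hωM (one_mem _))))
      (add_mem (add_mem (add_mem (mul_mem (ofNat_mem _ 3) (pow_mem hωM 2))
        (mul_mem (ofNat_mem _ 4) hωM)) (one_mem _)) h4)
  have h : x = y ^ 2 / ((t + 1) * algebraMap K L b) := by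
    rw [eq_div_iff (mul_ne_zero ht1 hB), hy, mul_comm]
  rw [h]
  exact div_mem (pow_mem hyM 2) (mul_mem (add_mem htM (one_mem _)) hBM)

/-- The division field is generated by the fourth root of unity `i`, the seventh root of unity `z`
and the ordinate of one of the points of order `7` given by radicals. -/
theorem divisionField_seven_eq_adjoin [DecidableEq L] [IsAlgClosed L] (hb : b ≠ 0) {i z : L}
    (hi : i ^ 2 = -1) (hz : IsPrimitiveRoot z 7) {j : Fin 6} {t x y : L}
    (ht : (2 * (t - omega i z j)) ^ 2 = theta i z j)
    (hx : x ^ 2 = t * algebraMap K L b) (hy : y ^ 2 = (t + 1) * algebraMap K L b * x) :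
    (∃ h : ((curve b).baseChange L).toAffine.Nonsingular x y,
      addOrderOf (Point.some x y h : Pt b L) = 7) ∧
    divisionField b L 7 = IntermediateField.adjoin K {i, z, y} := by
  have hB : algebraMap K L b ≠ 0 := (_root_.map_ne_zero _).mpr hb
  obtain ⟨r, hr⟩ := IsAlgClosed.exists_pow_nat_eq (theta i z j) two_pos
  have heq : y ^ 2 = x ^ 3 + algebraMap K L b * x := by
    linear_combination hy - x * hx
  have hq : aeval x (q7 b) = 0 := by
    rw [aeval_q7, hx]
    exact eval_q7t_radical hi hz _ hr (ht.trans hr.symm)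
  have hns := nonsingular_baseChange_curve two_ne_zero hb heq
  have hord := addOrderOf_some_eq_seven two_ne_zero hb hns hq
  obtain ⟨hx0, hxB, -⟩ :=
    ne_zero_of_eval_q7t_eq_zero two_ne_zero hB ((aeval_q7 (b := b) x).symm.trans hq)
  have ht1 : t + 1 ≠ 0 := by
    intro h
    apply hxB
    linear_combination hx + algebraMap K L b * h
  have hy0 : y ≠ 0 := by
    rintro rfl
    refine mul_ne_zero (mul_ne_zero ht1 hB) (pow_ne_zero_iff two_ne_zero |>.mp hx0) ?_
    rw [← hy, zero_pow two_ne_zero]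
  refine ⟨⟨hns, hord⟩, le_antisymm ?_ ?_⟩
  · have hsub := IntermediateField.subset_adjoin K ({i, z, y} : Set L)
    have hiM : i ∈ IntermediateField.adjoin K {i, z, y} := hsub (by simp)
    have hzM : z ∈ IntermediateField.adjoin K {i, z, y} := hsub (by simp)
    have hyM : y ∈ IntermediateField.adjoin K {i, z, y} := hsub (by simp)
    have hxM := X_mem_of_radical hb hi hz hiM hzM hyM ht ht1 hx hy
    refine IntermediateField.adjoin_le_iff.mpr ?_
    rintro c ⟨x', y', h', h7, hc⟩
    obtain ⟨m, hm, -⟩ :=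
      (seven_nsmul_eq_zero_iff_existsUnique two_ne_zero hb hi hord _).mp h7
    have := mem_of_eq_nsmul_add_nsmul_cm _ hi hiM hns hxM hyM h' hm
    rcases hc with rfl | rfl
    exacts [this.1, this.2]
  · have hyD := (mem_divisionField two_ne_zero hb heq hq).2
    -- The point (-x, iy) also has order 7, so i is the quotient of two ordinates.
    have hiD : i ∈ divisionField b L 7 := by
      have hiy : i * y ∈ divisionField b L 7 := by
        refine (mem_divisionField (x := -x) two_ne_zero hb ?_ ?_).2
        · linear_combination y ^ 2 * hi - heq
        · rw [aeval_q7, neg_sq, ← aeval_q7, hq]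
      convert div_mem hiy hyD using 1
      rw [mul_div_cancel_right₀ _ hy0]
    have hzD := root_of_unity_mem_divisionField hb hi hz hiD
    refine IntermediateField.adjoin_le_iff.mpr ?_
    rintro c (rfl | rfl | rfl)
    exacts [hiD, hzD, hyD]

end DivisionField

end SevenDivision

end

open Polynomial SevenDivision in
theorem theorem1 {K : Type*} [Field K] [NumberField K]
    {L : Type*} [Field L] [DecidableEq L] [Algebra K L] [IsAlgClosure K L]
    (b : K) (hb : b ≠ 0)
    (i ζ : L) (hi : i ^ 2 = -1) (hζ : IsPrimitiveRoot ζ 7) :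
    -- the points with the nested radicals as coordinates have order 7, and `K₇ = K(i, ζ₇, y)`,
    -- for every choice of the square roots `r`, `x`, `y`
    (∀ (j : Fin 6) (ε : ℤˣ) (r x y : L),
      r ^ 2 = theta i ζ j →
      x ^ 2 = omega i ζ j * algebraMap K L b + ((ε : ℤ) : L) * (1 / 2) * algebraMap K L b * r →
      y ^ 2 = (omega i ζ j + ((ε : ℤ) : L) * (1 / 2) * r + 1) * algebraMap K L b * x →
      (∃ h : ((curve b).baseChange L).toAffine.Nonsingular x y,
        addOrderOf (WeierstrassCurve.Affine.Point.some x y h : Pt b L) = 7) ∧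
      divisionField b L 7 = IntermediateField.adjoin K {i, ζ, y}) ∧
    -- `q₇` is the 7-division polynomial: its roots are the abscissas of the points of order 7
    (curve b).preΨ' 7 = q7 b ∧
    (∀ (x y : L) (h : ((curve b).baseChange L).toAffine.Nonsingular x y),
      7 • (WeierstrassCurve.Affine.Point.some x y h : Pt b L) = 0 ↔ aeval x (q7 b) = 0) ∧
    -- its factorisation in `t = x²`
    (∀ r : Fin 6 → L, (∀ j, r j ^ 2 = theta i ζ j) →
      (q7t b).map (algebraMap K L) =
        7 * ∏ j : Fin 6,
          ((X - C (omega i ζ j * algebraMap K L b + 1 / 2 * algebraMap K L b * r j)) *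
            (X - C (omega i ζ j * algebraMap K L b - 1 / 2 * algebraMap K L b * r j)))) ∧
    -- `{P, φ₁(P)}` is a basis of `E₁[7]` over `ℤ/7ℤ` for every point `P` of order 7
    (∀ P : Pt b L, addOrderOf P = 7 → ∀ Q : Pt b L,
      7 • Q = 0 ↔ ∃! c : Fin 7 × Fin 7, Q = (c.1 : ℕ) • P + (c.2 : ℕ) • cm b i hi P) := by
  have : IsAlgClosed L := IsAlgClosure.isAlgClosed K
  have : CharZero L := charZero_of_injective_algebraMap (algebraMap K L).injective
  refine ⟨fun j ε r x y hr hx hy => ?_, preΨ'_seven_curve b,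
    fun x y h => seven_nsmul_some_eq_zero_iff two_ne_zero hb h,
    fun r hr => map_q7t_eq_prod hi hζ b r hr,
    fun P hP Q => seven_nsmul_eq_zero_iff_existsUnique two_ne_zero hb hi hP Q⟩
  refine divisionField_seven_eq_adjoin (j := j) (t := omega i ζ j + ((ε : ℤ) : L) * (1 / 2) * r)
    hb hi hζ ?_ ?_ hy
  · have hε : ((ε : ℤ) : L) ^ 2 = 1 := by
      exact_mod_cast congrArg (Int.cast (R := L)) (Int.units_coe_mul_self ε |> (sq (ε : ℤ)).trans)
    linear_combination r ^ 2 * hε + hr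
  · linear_combination hx
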